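/- Let $d\ge 0$ be an integer. For $y\in\{-1,1\}$, $x\in\mathbb{R}^d$ and $\theta\in\mathbb{R}^{d+1}$ write $\tilde x=(1,x^\top)^\top$, $[u]_+=\max\{u,0\}$ and $$f(y|x;\theta)=\frac{\exp(-[1-y\tilde x^\top\theta]_+)}{\exp(-[1-\tilde x^\top\theta]_+)+\exp(-[1+\tilde x^\top\theta]_+)} .$$ Let $\mathbb{X}\subset\mathbb{R}^d$ and $\mathbb{S}\subset\mathbb{R}^{d+1}$ be compact, and let $(X_1,Y_1),(X_2,Y_2),\dots$ be independent, not necessarily identically distributed, random pairs with values in $\mathbb{X}\times\{-1,1\}$. (Nonrandom $X_i=x_i$, i.e. conditioning on the covariates, and identically distributed pairs are both allowed. The law of $Y_i$ given $X_i$ need not be of the form $f(\cdot|X_i;\theta)$, so the model may be misspecified.) Put $$l_n(\theta)=\frac1n\sum_{i=1}^n\log f(Y_i|X_i;\theta),\qquad \mathbb{S}_n=\{\theta\in\mathrm{int}(\mathbb{S}):\theta\text{ is a local maximizer of }l_n\}.$$ Let $\theta_0\in\mathrm{int}(\mathbb{S})$ be such that, for all sufficiently large $n$, the function $\theta\mapsto\mathbb{E}[l_n(\theta)]$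 attains a strict local maximum at $\theta_0$. Assume that there is an open convex neighborhood $U$ of $\theta_0$, not depending on $i$, such that for every $i$, almost surely, $\theta\mapsto\log f(Y_i|X_i;\theta)$ is three times differentiable on $U$. Assume that the limits $$A=\lim_{n\to\infty}\frac1n\sum_{i=1}^n\mathbb{E}\left[\frac{\partial^2\log f(Y_i|X_i;\theta)}{\partial\theta\,\partial\theta^\top}\Big|_{\theta_0}\right],\qquad B=\lim_{n\to\infty}\frac1n\sum_{i=1}^n\mathbb{E}\left[\frac{\partial\log f(Y_i|X_i;\theta)}{\partial\theta}\Big|_{\theta_0}\frac{\partial\log f(Y_i|X_i;\theta)}{\partial\theta^\top}\Big|_{\theta_0}\right]$$ exist and that $A$ is nonsingular. Let $\hat\theta_n$ be random vectors such that, for each $n$, almost surely, $\hat\theta_n\in\mathbb{S}_n$ whenever $\mathbb{S}_n\neq\emptyset$, and suppose that $\hat\theta_n\to\theta_0$ in probability. Then $\sqrt n(\hat\theta_n-\theta_0)$ converges in law to the normal distribution $N(0,A^{-1}BA^{-1})$. -/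

import Mathlib

open MeasureTheory ProbabilityTheory Filter Topology

/-- The augmented covariate `x̃ = (1, x) ∈ ℝ^{d+1}`. -/
noncomputable def augment {d : ℕ} (x : EuclideanSpace ℝ (Fin d)) :
    EuclideanSpace ℝ (Fin (d + 1)) :=
  WithLp.toLp 2 (Fin.cons 1 (fun j => x j))

/-- The linear predictor `x̃ᵀ θ = α + xᵀ β`, where `θ = (α, β)`. -/
noncomputable def linPred {d : ℕ} (x : EuclideanSpace ℝ (Fin d))
    (θ : EuclideanSpace ℝ (Fin (d + 1))) : ℝ :=
  inner ℝ (augment x) θ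

/-- The positive part `[u]₊ = max {u, 0}`. -/
noncomputable def hingePos (u : ℝ) : ℝ := max u 0

/-- The conditional probability `f(y | x; θ)` of the response `y ∈ {-1, 1}` in the binary-response
model based on the support vector machine. -/
noncomputable def svmProb {d : ℕ} (y : ℝ) (x : EuclideanSpace ℝ (Fin d))
    (θ : EuclideanSpace ℝ (Fin (d + 1))) : ℝ :=
  Real.exp (-hingePos (1 - y * linPred x θ)) /
    (Real.exp (-hingePos (1 - linPred x θ)) + Real.exp (-hingePos (1 + linPred x θ)))

/-- `log f(y | x; θ)`. -/
noncomputable def svmLogProb {d : ℕ} (y : ℝ) (x : EuclideanSpace ℝ (Fin d))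
    (θ : EuclideanSpace ℝ (Fin (d + 1))) : ℝ :=
  Real.log (svmProb y x θ)

/-- The averaged log-likelihood `l_n(θ) = n⁻¹ ∑_{i=1}^n log f(Y_i | X_i; θ)` of the first `n`
members of a data sequence `(x_i, y_i)`. -/
noncomputable def avgLogLik {d : ℕ} (x : ℕ → EuclideanSpace ℝ (Fin d)) (y : ℕ → ℝ) (n : ℕ)
    (θ : EuclideanSpace ℝ (Fin (d + 1))) : ℝ :=
  (n : ℝ)⁻¹ * ∑ i ∈ Finset.range n, svmLogProb (y i) (x i) θ

/-- The set `S_n` of the local maximizers of `l_n` that lie in the interior of `S`. -/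
def localMaximizers {d : ℕ} (S : Set (EuclideanSpace ℝ (Fin (d + 1))))
    (x : ℕ → EuclideanSpace ℝ (Fin d)) (y : ℕ → ℝ) (n : ℕ) :
    Set (EuclideanSpace ℝ (Fin (d + 1))) :=
  {θ | θ ∈ interior S ∧ IsLocalMax (avgLogLik x y n) θ}

/-- `g` attains a strict local maximum at `a`. -/
def AttainsStrictLocalMax {E : Type*} [TopologicalSpace E] (g : E → ℝ) (a : E) : Prop :=
  ∀ᶠ θ in 𝓝[≠] a, g θ < g a

/-- `g` is three times (Fréchet) differentiable on the open set `U`. -/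
def ThreeTimesDifferentiableOn {E : Type*} [NormedAddCommGroup E] [NormedSpace ℝ E]
    (g : E → ℝ) (U : Set E) : Prop :=
  ∀ k < 3, DifferentiableOn ℝ (iteratedFDeriv ℝ k g) U

/-- The score: the vector of the partial derivatives `∂ log f(y | x; θ) / ∂θ_j`. -/
noncomputable def svmScore {d : ℕ} (y : ℝ) (x : EuclideanSpace ℝ (Fin d))
    (θ : EuclideanSpace ℝ (Fin (d + 1))) (j : Fin (d + 1)) : ℝ :=
  fderiv ℝ (svmLogProb y x) θ (EuclideanSpace.single j 1)

/-- The Hessian: the matrix of the second partial derivatives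
`∂² log f(y | x; θ) / ∂θ_j ∂θ_k`. -/
noncomputable def svmHessian {d : ℕ} (y : ℝ) (x : EuclideanSpace ℝ (Fin d))
    (θ : EuclideanSpace ℝ (Fin (d + 1))) : Matrix (Fin (d + 1)) (Fin (d + 1)) ℝ :=
  Matrix.of fun j k =>
    iteratedFDeriv ℝ 2 (svmLogProb y x) θ
      ![EuclideanSpace.single j 1, EuclideanSpace.single k 1]

/-- The averaged expected Hessian `n⁻¹ ∑_{i=1}^n E[∂² log f(Y_i | X_i; θ) / ∂θ ∂θᵀ]`. -/
noncomputable def avgExpHessian {d : ℕ} {Ω : Type*} [MeasurableSpace Ω] (P : Measure Ω)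
    (X : ℕ → Ω → EuclideanSpace ℝ (Fin d)) (Y : ℕ → Ω → ℝ)
    (θ : EuclideanSpace ℝ (Fin (d + 1))) (n : ℕ) : Matrix (Fin (d + 1)) (Fin (d + 1)) ℝ :=
  Matrix.of fun j k =>
    (n : ℝ)⁻¹ * ∑ i ∈ Finset.range n, ∫ ω, svmHessian (Y i ω) (X i ω) θ j k ∂P

/-- The averaged expected outer product of the scores
`n⁻¹ ∑_{i=1}^n E[(∂ log f(Y_i | X_i; θ) / ∂θ) (∂ log f(Y_i | X_i; θ) / ∂θᵀ)]`. -/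
noncomputable def avgExpScoreOuter {d : ℕ} {Ω : Type*} [MeasurableSpace Ω] (P : Measure Ω)
    (X : ℕ → Ω → EuclideanSpace ℝ (Fin d)) (Y : ℕ → Ω → ℝ)
    (θ : EuclideanSpace ℝ (Fin (d + 1))) (n : ℕ) : Matrix (Fin (d + 1)) (Fin (d + 1)) ℝ :=
  Matrix.of fun j k =>
    (n : ℝ)⁻¹ * ∑ i ∈ Finset.range n,
      ∫ ω, svmScore (Y i ω) (X i ω) θ j * svmScore (Y i ω) (X i ω) θ k ∂P

/-! The hinge is the only source of non-smoothness. With t = y x̃ᵀθ one has log f = `logisticLog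
(svmMargin t)`, where `svmMargin` is piecewise linear with kinks at t = ±1. Since `logisticLog` has
a smooth inverse and x̃ ≠ 0, differentiability of log f on U forbids t = ±1 there; as U is convex, t
then stays on one linear piece. Hence on U each summand is the log-likelihood of a logistic
regression whose bounded covariate w and offset depend only on (X_i, Y_i) and θ₀
(`svmLogProb_eq_of_differentiableOn`).

For logistic regression the negative Hessian is an average of σ'(·) w wᵀ with σ' > 0, so -A is a
limit of positive semidefinite matrices and, being nonsingular, is positive definite. The gradient
has a linear expansion at θ₀ with a quadratic error that is uniform in the data
(`norm_logisticAvgGrad_sub_le`). Let g be the gradient at θ₀. If g is small and the Hessian is close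
to A, there is a local maximizer near θ₀ (`exists_isLocalMax_logisticAvg`); so S_n is nonempty with
probability tending to one, and the selected θ̂_n is then a critical point. A critical point near θ₀
equals θ₀ + (-A)⁻¹g up to a small relative error (`norm_sub_le_of_logisticAvgGrad_eq_zero`).

Probability enters through a weak law for the Hessian and a central limit theorem for √n(-A)⁻¹g. As
θ₀ maximizes the expected log-likelihood for all large n, the expected scores sum to zero for all
large n; hence all but finitely many of them vanish, and B, a limit of uncentered second moments, is
the limiting covariance of √n g. Slutsky's theorem concludes. -/

/-! ### The logistic function: derivatives and global Lipschitz bounds -/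

/-- The logarithm of the logistic function. -/
noncomputable def logisticLog (v : ℝ) : ℝ := -Real.log (1 + Real.exp (-v))

/-- The derivative of the logistic function. -/
noncomputable def logisticDensity (v : ℝ) : ℝ := Real.sigmoid v * (1 - Real.sigmoid v)

lemma hasDerivAt_logisticLog (v : ℝ) : HasDerivAt logisticLog (1 - Real.sigmoid v) v := by
  have h : HasDerivAt (fun v : ℝ => 1 + Real.exp (-v)) (-Real.exp (-v)) v := by
    simpa using ((hasDerivAt_neg v).exp.const_add 1)
  have hpos : (1 + Real.exp (-v)) ≠ 0 := by positivity
  have h2 := (h.log hpos).neg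
  refine h2.congr_deriv ?_
  rw [Real.sigmoid_def]
  field_simp
  ring

lemma continuous_logisticLog : Continuous logisticLog :=
  continuous_iff_continuousAt.2 fun v => (hasDerivAt_logisticLog v).continuousAt

lemma hasDerivAt_one_sub_sigmoid (v : ℝ) :
    HasDerivAt (fun v => 1 - Real.sigmoid v) (-logisticDensity v) v :=
  (Real.hasDerivAt_sigmoid v).const_sub 1

lemma continuous_logisticDensity : Continuous logisticDensity := by
  unfold logisticDensity
  fun_prop

lemma logisticDensity_nonneg (v : ℝ) : 0 ≤ logisticDensity v :=
  mul_nonneg (Real.sigmoid_nonneg v) (sub_nonneg.2 (Real.sigmoid_le_one v))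

lemma logisticDensity_le_one (v : ℝ) : logisticDensity v ≤ 1 :=
  mul_le_one₀ (Real.sigmoid_le_one v) (sub_nonneg.2 (Real.sigmoid_le_one v))
    (by linarith [Real.sigmoid_nonneg v])

lemma abs_one_sub_sigmoid_le_one (v : ℝ) : |1 - Real.sigmoid v| ≤ 1 := by
  rw [abs_le]
  constructor <;> linarith [Real.sigmoid_nonneg v, Real.sigmoid_le_one v]

lemma abs_logisticLog_sub_le (v w : ℝ) : |logisticLog w - logisticLog v| ≤ |w - v| := by
  simpa using Convex.norm_image_sub_le_of_norm_hasDerivWithin_le (C := 1) (s := Set.univ)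
    (fun x _ => (hasDerivAt_logisticLog x).hasDerivWithinAt)
    (fun x _ => abs_one_sub_sigmoid_le_one x) convex_univ (Set.mem_univ v) (Set.mem_univ w)

lemma abs_logisticDensity_sub_le (v w : ℝ) :
    |logisticDensity w - logisticDensity v| ≤ |w - v| := by
  have hd (x : ℝ) : HasDerivAt logisticDensity
      (logisticDensity x * (1 - 2 * Real.sigmoid x)) x := by
    refine ((Real.hasDerivAt_sigmoid x).mul (hasDerivAt_one_sub_sigmoid x)).congr_deriv ?_
    unfold logisticDensity
    ring
  simpa using Convex.norm_image_sub_le_of_norm_hasDerivWithin_le (C := 1) (s := Set.univ)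
    (fun x _ => (hd x).hasDerivWithinAt)
    (fun x _ => by
      rw [Real.norm_eq_abs, abs_mul, abs_of_nonneg (logisticDensity_nonneg x)]
      refine mul_le_one₀ (logisticDensity_le_one x) (abs_nonneg _) ?_
      rw [abs_le]
      constructor <;> linarith [Real.sigmoid_nonneg x, Real.sigmoid_le_one x])
    convex_univ (Set.mem_univ v) (Set.mem_univ w)

/-- The derivative of the sigmoid minus its tangent at v is at most |w - v| between v and w, because
`logisticDensity` is 1-Lipschitz. The bound is global, so the expansion of the gradient needs no
restriction on θ. -/
lemma abs_sigmoid_sub_linear_le (v w : ℝ) :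
    |Real.sigmoid w - Real.sigmoid v - logisticDensity v * (w - v)| ≤ |w - v| ^ 2 := by
  have hd (x : ℝ) : HasDerivAt (fun x => Real.sigmoid x - logisticDensity v * (x - v))
      (logisticDensity x - logisticDensity v) x := by
    simpa using! (Real.hasDerivAt_sigmoid x).sub
      (((hasDerivAt_id x).sub_const v).const_mul (logisticDensity v))
  have := Convex.norm_image_sub_le_of_norm_hasDerivWithin_le (C := |w - v|) (s := Set.uIcc v w)
    (fun x _ => (hd x).hasDerivWithinAt)
    (fun x hx => (abs_logisticDensity_sub_le v x).trans (Set.abs_sub_left_of_mem_uIcc hx))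
    (convex_uIcc v w) Set.left_mem_uIcc Set.right_mem_uIcc
  simp only [sub_self, mul_zero, sub_zero, Real.norm_eq_abs] at this
  rw [sq]
  convert this using 2
  ring

/-! ### Deterministic analysis of an averaged logistic log-likelihood -/

section LogisticAverage

variable {E : Type*} [NormedAddCommGroup E] [InnerProductSpace ℝ E]

/-- The averaged logistic log-likelihood with covariates `w i` and offsets `b i`. -/
noncomputable def logisticAvg (w : ℕ → E) (b : ℕ → ℝ) (n : ℕ) (θ : E) : ℝ :=
  (n : ℝ)⁻¹ * ∑ i ∈ Finset.range n, logisticLog (inner ℝ (w i) θ + b i)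

/-- The gradient of `logisticAvg`. -/
noncomputable def logisticAvgGrad (w : ℕ → E) (b : ℕ → ℝ) (n : ℕ) (θ : E) : E :=
  (n : ℝ)⁻¹ • ∑ i ∈ Finset.range n, (1 - Real.sigmoid (inner ℝ (w i) θ + b i)) • w i

/-- The negative Hessian of `logisticAvg`. -/
noncomputable def logisticAvgInfo (w : ℕ → E) (b : ℕ → ℝ) (n : ℕ) (θ : E) : E →L[ℝ] E :=
  (n : ℝ)⁻¹ • ∑ i ∈ Finset.range n,
    logisticDensity (inner ℝ (w i) θ + b i) • (innerSL ℝ (w i)).smulRight (w i)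

lemma hasFDerivAt_logisticLog_inner (w : E) (b : ℝ) (θ : E) :
    HasFDerivAt (fun θ => logisticLog (inner ℝ w θ + b))
      (innerSL ℝ ((1 - Real.sigmoid (inner ℝ w θ + b)) • w)) θ := by
  have h : HasFDerivAt (fun θ => inner ℝ w θ + b) (innerSL ℝ w) θ :=
    ((innerSL ℝ w).hasFDerivAt).add_const b
  simpa using! (hasDerivAt_logisticLog (inner ℝ w θ + b)).comp_hasFDerivAt θ h

lemma hasFDerivAt_logisticAvg (w : ℕ → E) (b : ℕ → ℝ) (n : ℕ) (θ : E) :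
    HasFDerivAt (logisticAvg w b n) (innerSL ℝ (logisticAvgGrad w b n θ)) θ := by
  have h := (HasFDerivAt.fun_sum (u := Finset.range n)
    (fun i _ => hasFDerivAt_logisticLog_inner (w i) (b i) θ)).const_mul (n : ℝ)⁻¹
  simpa only [logisticAvgGrad, map_smul, map_sum] using! h

lemma logisticAvgGrad_eq_zero_of_isLocalMax {w : ℕ → E} {b : ℕ → ℝ} {n : ℕ} {θ : E}
    (h : IsLocalMax (logisticAvg w b n) θ) : logisticAvgGrad w b n θ = 0 := by
  have := h.hasFDerivAt_eq_zero (hasFDerivAt_logisticAvg w b n θ)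
  have h2 := congrArg (fun T => T (logisticAvgGrad w b n θ)) this
  simpa using h2

lemma norm_inv_smul_sum_le {F : Type*} [NormedAddCommGroup F] [NormedSpace ℝ F] {n : ℕ} {C : ℝ}
    (hC : 0 ≤ C) (f : ℕ → F) (h : ∀ i, ‖f i‖ ≤ C) :
    ‖(n : ℝ)⁻¹ • ∑ i ∈ Finset.range n, f i‖ ≤ C := by
  rcases Nat.eq_zero_or_pos n with rfl | hn
  · simpa
  rw [norm_smul, norm_inv, Real.norm_natCast, inv_mul_le_iff₀ (by positivity)]
  refine (norm_sum_le _ _).trans ((Finset.sum_le_sum fun i _ => h i).trans_eq ?_)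
  simp

/-- Taylor's formula for the gradient; the plus sign appears because `logisticAvgInfo` is the
negative Hessian. In K ^ 3, two factors come from the squared increment of the linear predictor and
one from the covariate that multiplies the sigmoid. -/
lemma norm_logisticAvgGrad_sub_le {w : ℕ → E} {K : ℝ} (hw : ∀ i, ‖w i‖ ≤ K) (b : ℕ → ℝ) (n : ℕ)
    (θ θ' : E) :
    ‖logisticAvgGrad w b n θ' - logisticAvgGrad w b n θ + logisticAvgInfo w b n θ (θ' - θ)‖ ≤
      K ^ 3 * ‖θ' - θ‖ ^ 2 := by
  have hK : 0 ≤ K := (norm_nonneg _).trans (hw 0)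
  have heq : logisticAvgGrad w b n θ' - logisticAvgGrad w b n θ
        + logisticAvgInfo w b n θ (θ' - θ) =
      (n : ℝ)⁻¹ • ∑ i ∈ Finset.range n,
        (-(Real.sigmoid (inner ℝ (w i) θ' + b i) - Real.sigmoid (inner ℝ (w i) θ + b i)
          - logisticDensity (inner ℝ (w i) θ + b i) *
            ((inner ℝ (w i) θ' + b i) - (inner ℝ (w i) θ + b i)))) • w i := by
    simp only [logisticAvgGrad, logisticAvgInfo, smul_apply,
      sum_apply, ContinuousLinearMap.smulRight_apply, innerSL_apply_apply]
    rw [← smul_sub, ← smul_add, ← Finset.sum_sub_distrib, ← Finset.sum_add_distrib]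
    congr 1
    refine Finset.sum_congr rfl fun i _ => ?_
    rw [smul_smul, ← sub_smul, ← add_smul, inner_sub_right]
    congr 1
    ring
  rw [heq]
  refine norm_inv_smul_sum_le (by positivity) _ fun i => ?_
  rw [norm_smul, norm_neg, Real.norm_eq_abs]
  have h1 := abs_sigmoid_sub_linear_le (inner ℝ (w i) θ + b i) (inner ℝ (w i) θ' + b i)
  have h2 : |(inner ℝ (w i) θ' + b i) - (inner ℝ (w i) θ + b i)| ≤ K * ‖θ' - θ‖ := by
    rw [add_sub_add_right_eq_sub, ← inner_sub_right]
    exact (abs_real_inner_le_norm _ _).trans (by gcongr; exact hw i)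
  calc _ ≤ (K * ‖θ' - θ‖) ^ 2 * K := by
        gcongr
        · exact h1.trans (by gcongr)
        · exact hw i
    _ = _ := by ring

/-- A logistic log-likelihood whose gradient at `θ₀` is small and whose negative Hessian at
`θ₀` is close to a coercive operator has a local maximizer near `θ₀`. -/
lemma exists_isLocalMax_logisticAvg [FiniteDimensional ℝ E] {w : ℕ → E} {K : ℝ}
    (hw : ∀ i, ‖w i‖ ≤ K) (b : ℕ → ℝ) (n : ℕ) {θ₀ : E} {H : E →L[ℝ] E} {c r : ℝ} (hr : 0 < r)
    (hH : ∀ u, c * ‖u‖ ^ 2 ≤ inner ℝ (H u) u)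
    (hHn : ‖logisticAvgInfo w b n θ₀ - H‖ ≤ c / 4) (hKr : K ^ 3 * r ≤ c / 4)
    (hg : ‖logisticAvgGrad w b n θ₀‖ < c * r / 4) :
    ∃ θ ∈ Metric.ball θ₀ r, IsLocalMax (logisticAvg w b n) θ := by
  have hcont : Continuous (logisticAvg w b n) :=
    continuous_iff_continuousAt.2 fun θ => (hasFDerivAt_logisticAvg w b n θ).continuousAt
  have hc : 0 < c := by
    have := (norm_nonneg _).trans_lt hg
    by_contra! h
    nlinarith
  -- The gradient points inward on the sphere: coercivity contributes c r², while the Taylor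
  -- remainder, the gradient at θ₀ and the error in the Hessian each cost at most c r² / 4.
  have hsphere : ∀ θ ∈ Metric.sphere θ₀ r, 0 < inner ℝ (logisticAvgGrad w b n θ) (θ₀ - θ) := by
    intro θ hθ
    have hδ : ‖θ - θ₀‖ = r := by simpa [dist_eq_norm] using hθ
    set g := logisticAvgGrad w b n θ₀
    set T := logisticAvgInfo w b n θ₀
    set R := logisticAvgGrad w b n θ - g + T (θ - θ₀) with hR
    have hRn : ‖R‖ ≤ c / 4 * r := by
      refine (norm_logisticAvgGrad_sub_le hw b n θ₀ θ).trans ?_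
      rw [hδ]
      nlinarith
    have h1 : inner ℝ (logisticAvgGrad w b n θ) (θ₀ - θ) =
        -(inner ℝ R (θ - θ₀)) - inner ℝ g (θ - θ₀) + inner ℝ ((T - H) (θ - θ₀)) (θ - θ₀)
          + inner ℝ (H (θ - θ₀)) (θ - θ₀) := by
      rw [← neg_sub θ θ₀, inner_neg_right, sub_apply, inner_sub_left,
        show logisticAvgGrad w b n θ = R + g - T (θ - θ₀) by rw [hR]; abel, inner_sub_left,
        inner_add_left]
      ring
    have h2 : inner ℝ R (θ - θ₀) ≤ c / 4 * r * r :=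
      (real_inner_le_norm _ _).trans (by rw [hδ]; gcongr)
    have h3 : inner ℝ g (θ - θ₀) ≤ c * r / 4 * r :=
      (real_inner_le_norm _ _).trans (by rw [hδ]; gcongr)
    have h4 : -(c / 4 * r * r) ≤ inner ℝ ((T - H) (θ - θ₀)) (θ - θ₀) := by
      refine neg_le_of_abs_le ((abs_real_inner_le_norm _ _).trans ?_)
      rw [hδ]
      gcongr
      refine (ContinuousLinearMap.le_opNorm _ _).trans ?_
      rw [hδ]
      gcongr
    have h5 := hH (θ - θ₀)
    rw [hδ] at h5
    have : 0 < c * r * r := by positivity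
    rw [h1]
    nlinarith
  obtain ⟨θ, hθ, hmax⟩ := (isCompact_closedBall θ₀ r).exists_isMaxOn
    ⟨θ₀, Metric.mem_closedBall_self hr.le⟩ hcont.continuousOn
  have hball : θ ∈ Metric.ball θ₀ r := by
    by_contra hnot
    have hs : θ ∈ Metric.sphere θ₀ r :=
      le_antisymm (Metric.mem_closedBall.1 hθ) (not_lt.1 hnot)
    -- At a maximizer on the boundary the derivative towards the center would be nonpositive,
    -- against `hsphere`.
    have hle := hmax.localize.hasFDerivWithinAt_nonpos
      (hasFDerivAt_logisticAvg w b n θ).hasFDerivWithinAt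
      (sub_mem_posTangentConeAt_of_segment_subset
        ((convex_closedBall θ₀ r).segment_subset hθ (Metric.mem_closedBall_self hr.le)))
    exact absurd hle (not_le.2 (by simpa using hsphere θ hs))
  exact ⟨θ, hball, hmax.isLocalMax (Filter.mem_of_superset
    (Metric.isOpen_ball.mem_nhds hball) Metric.ball_subset_closedBall)⟩

/-- The linearization error of a critical point of the logistic log-likelihood. -/
lemma norm_sub_le_of_logisticAvgGrad_eq_zero {w : ℕ → E} {K : ℝ}
    (hw : ∀ i, ‖w i‖ ≤ K) (b : ℕ → ℝ) (n : ℕ) {θ₀ θ : E} {H Hi : E →L[ℝ] E}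
    (hHi : ∀ u, Hi (H u) = u) (hθ : logisticAvgGrad w b n θ = 0) {ρ : ℝ}
    (hρ : ‖Hi‖ * (‖logisticAvgInfo w b n θ₀ - H‖ + K ^ 3 * ‖θ - θ₀‖) ≤ ρ) (hρ2 : ρ ≤ 1 / 2) :
    ‖θ - θ₀ - Hi (logisticAvgGrad w b n θ₀)‖ ≤
      ρ * (2 * ‖Hi (logisticAvgGrad w b n θ₀)‖) := by
  set g := logisticAvgGrad w b n θ₀
  set T := logisticAvgInfo w b n θ₀
  set δ := θ - θ₀
  have hR := norm_logisticAvgGrad_sub_le hw b n θ₀ θ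
  rw [hθ] at hR
  -- As the gradient vanishes at θ, H δ - g consists only of the Taylor remainder and the error T -
  -- H in the Hessian.
  have h1 : δ - Hi g = Hi ((0 - g + T δ) - (T - H) δ) := by
    rw [sub_apply, show (0 - g + T δ) - (T δ - H δ) = H δ - g by abel, map_sub,
      hHi]
  have h2 : ‖δ - Hi g‖ ≤ ρ * ‖δ‖ := by
    rw [h1]
    calc _ ≤ ‖Hi‖ * (K ^ 3 * ‖δ‖ ^ 2 + ‖T - H‖ * ‖δ‖) := by
          refine (Hi.le_opNorm _).trans ?_
          gcongr
          refine (norm_sub_le _ _).trans ?_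
          gcongr
          exact (T - H).le_opNorm _
      _ = ‖Hi‖ * (‖T - H‖ + K ^ 3 * ‖δ‖) * ‖δ‖ := by ring
      _ ≤ _ := by gcongr
  -- Since ρ ≤ 1/2, the term ρ‖δ‖ is absorbed in the left-hand side.
  have h3 : ‖δ‖ ≤ 2 * ‖Hi g‖ := by
    have h4 : ‖δ‖ ≤ ‖δ - Hi g‖ + ‖Hi g‖ := by simpa using norm_add_le (δ - Hi g) (Hi g)
    nlinarith [norm_nonneg δ]
  have hK : 0 ≤ K := (norm_nonneg _).trans (hw 0)
  have hρ0 : 0 ≤ ρ := le_trans (by positivity) hρ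
  exact h2.trans (by gcongr)

end LogisticAverage

/-! ### Central limit theorem for bounded independent vectors -/

/-- Replace the factors one at a time; the others have modulus at most 1. This reduces the central
limit theorem to comparing each characteristic function with a Gaussian one. -/
lemma norm_prod_sub_prod_le {ι : Type*} (s : Finset ι) (z e : ι → ℂ) (hz : ∀ i ∈ s, ‖z i‖ ≤ 1)
    (he : ∀ i ∈ s, ‖e i‖ ≤ 1) : ‖∏ i ∈ s, z i - ∏ i ∈ s, e i‖ ≤ ∑ i ∈ s, ‖z i - e i‖ := by
  classical
  induction s using Finset.induction_on with
  | empty => simp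
  | insert a s ha ih =>
    rw [Finset.prod_insert ha, Finset.prod_insert ha, Finset.sum_insert ha]
    have hs := ih (fun i hi => hz i (Finset.mem_insert_of_mem hi))
      (fun i hi => he i (Finset.mem_insert_of_mem hi))
    have hz1 : ‖∏ i ∈ s, z i‖ ≤ 1 := by
      rw [norm_prod]
      exact Finset.prod_le_one (fun _ _ => norm_nonneg _)
        fun i hi => hz i (Finset.mem_insert_of_mem hi)
    have ha1 := he a (Finset.mem_insert_self a s)
    calc ‖z a * ∏ i ∈ s, z i - e a * ∏ i ∈ s, e i‖
        = ‖(z a - e a) * ∏ i ∈ s, z i + e a * (∏ i ∈ s, z i - ∏ i ∈ s, e i)‖ := by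
          congr 1; ring
      _ ≤ ‖z a - e a‖ * 1 + 1 * ∑ i ∈ s, ‖z i - e i‖ := by
          refine (norm_add_le _ _).trans ?_
          rw [norm_mul, norm_mul]
          gcongr
      _ = _ := by ring

lemma norm_cexp_mul_I_sub_le {x : ℝ} (hx : |x| ≤ 1) :
    ‖Complex.exp (x * Complex.I) - (1 + x * Complex.I - (x ^ 2 / 2 : ℝ))‖ ≤ |x| ^ 3 := by
  have hn : ‖(x * Complex.I : ℂ)‖ = |x| := by simp
  have h := Complex.exp_bound (x := x * Complex.I) (by rwa [hn]) (n := 3) (by norm_num)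
  rw [hn] at h
  have heq : ∑ m ∈ Finset.range 3, (x * Complex.I : ℂ) ^ m / m.factorial =
      1 + x * Complex.I - (x ^ 2 / 2 : ℝ) := by
    simp [Finset.sum_range_succ, mul_pow, Nat.factorial]
    ring
  rw [heq] at h
  refine h.trans (mul_le_of_le_one_right (by positivity) ?_)
  norm_num [Nat.factorial]

section CLT

variable {Ω : Type*} [MeasurableSpace Ω] {P : Measure Ω} [IsProbabilityMeasure P]

/-- Both terms are compared with 1 - s²v/2, where v is the second moment: the cubic error is the
Taylor remainder of exp(isξ), the quartic one that of exp(-s²v/2). -/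
lemma norm_integral_cexp_sub_le {ξ : Ω → ℝ} (hξ : AEMeasurable ξ P) {c s : ℝ} (hs : 0 ≤ s)
    (hc : ∀ᵐ ω ∂P, |ξ ω| ≤ c) (hcs : c * s ≤ 1) (hmean : ∫ ω, ξ ω ∂P = 0) :
    ‖∫ ω, Complex.exp ((s * ξ ω : ℝ) * Complex.I) ∂P
        - Complex.exp (-(s ^ 2 * ∫ ω, ξ ω ^ 2 ∂P) / 2 : ℝ)‖ ≤ (c * s) ^ 3 + (c * s) ^ 4 := by
  have hc0 : 0 ≤ c := by
    obtain ⟨ω, hω⟩ := hc.exists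
    exact (abs_nonneg _).trans hω
  have hi1 : Integrable ξ P := Integrable.of_bound hξ.aestronglyMeasurable c hc
  have hi2 : Integrable (fun ω => ξ ω ^ 2) P :=
    Integrable.of_bound (by fun_prop) (c ^ 2) (hc.mono fun ω h => by
      rw [norm_pow]; exact pow_le_pow_left₀ (norm_nonneg _) h 2)
  have hv0 : 0 ≤ ∫ ω, ξ ω ^ 2 ∂P := integral_nonneg fun ω => sq_nonneg _
  have hv : ∫ ω, ξ ω ^ 2 ∂P ≤ c ^ 2 := by
    have := norm_integral_le_of_norm_le_const (μ := P) (f := fun ω => ξ ω ^ 2) (C := c ^ 2)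
      (hc.mono fun ω h => by rw [norm_pow]; exact pow_le_pow_left₀ (norm_nonneg _) h 2)
    simpa using (le_abs_self _).trans this
  have hie : Integrable (fun ω => Complex.exp ((s * ξ ω : ℝ) * Complex.I)) P :=
    Integrable.of_bound (by fun_prop) 1 (ae_of_all _ fun ω => (Complex.norm_exp_ofReal_mul_I _).le)
  set v := ∫ ω, ξ ω ^ 2 ∂P with hvdef
  have e1 : Integrable (fun ω => ((s * ξ ω : ℝ) : ℂ) * Complex.I) P :=
    ((hi1.const_mul s).ofReal).mul_const _
  have e2 : Integrable (fun ω => (((s * ξ ω) ^ 2 / 2 : ℝ) : ℂ)) P := by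
    simp_rw [mul_pow]
    exact ((hi2.const_mul (s ^ 2)).div_const 2).ofReal
  have e3 : Integrable (fun ω => (1 + (s * ξ ω : ℝ) * Complex.I : ℂ)) P :=
    (integrable_const _).add e1
  have hi3 : Integrable
      (fun ω => (1 + (s * ξ ω : ℝ) * Complex.I - ((s * ξ ω) ^ 2 / 2 : ℝ) : ℂ)) P := e3.sub e2
  have hint : ∫ ω, (1 + (s * ξ ω : ℝ) * Complex.I - ((s * ξ ω) ^ 2 / 2 : ℝ) : ℂ) ∂P =
      (1 - s ^ 2 * v / 2 : ℝ) := by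
    rw [integral_sub e3 e2, integral_add (integrable_const _) e1,
      integral_mul_const, integral_complex_ofReal, integral_complex_ofReal, integral_const_mul,
      hmean]
    simp_rw [mul_pow]
    rw [integral_div, integral_const_mul, ← hvdef]
    push_cast
    simp
  have h1 : ‖∫ ω, Complex.exp ((s * ξ ω : ℝ) * Complex.I) ∂P - (1 - s ^ 2 * v / 2 : ℝ)‖
      ≤ (c * s) ^ 3 := by
    rw [← hint, ← integral_sub hie hi3]
    refine (norm_integral_le_of_norm_le_const (C := (c * s) ^ 3) (hc.mono fun ω h => ?_)).trans
      (by simp)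
    have hle : |s * ξ ω| ≤ c * s := by
      rw [abs_mul, abs_of_nonneg hs, mul_comm]
      gcongr
    exact (norm_cexp_mul_I_sub_le (hle.trans hcs)).trans (by gcongr)
  have h2 : ‖((1 - s ^ 2 * v / 2 : ℝ) : ℂ) - Complex.exp (-(s ^ 2 * v) / 2 : ℝ)‖ ≤ (c * s) ^ 4 := by
    rw [← Complex.ofReal_exp, ← Complex.ofReal_sub, Complex.norm_real, Real.norm_eq_abs,
      abs_sub_comm]
    have hx0 : 0 ≤ s ^ 2 * v / 2 := by positivity
    have hx : s ^ 2 * v / 2 ≤ (c * s) ^ 2 := by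
      rw [mul_pow, mul_comm (c ^ 2)]
      have := mul_le_mul_of_nonneg_left hv (sq_nonneg s)
      linarith [mul_nonneg (sq_nonneg s) hv0]
    have hcs0 : 0 ≤ c * s := by positivity
    have hx1 : s ^ 2 * v / 2 ≤ 1 := hx.trans (pow_le_one₀ hcs0 hcs)
    have := Real.exp_bound (x := -(s ^ 2 * v) / 2) (n := 2)
      (by rw [neg_div, abs_neg, abs_of_nonneg hx0]; exact hx1) (by norm_num)
    rw [neg_div, abs_neg, abs_of_nonneg hx0] at this
    have e : ∑ m ∈ Finset.range 2, (-(s ^ 2 * v / 2)) ^ m / (m.factorial : ℝ) =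
        1 - s ^ 2 * v / 2 := by
      simp [Finset.sum_range_succ]
      ring
    rw [e] at this
    rw [neg_div]
    refine this.trans ?_
    calc (s ^ 2 * v / 2) ^ 2 * ((Nat.succ 2 : ℝ) / ((Nat.factorial 2 : ℝ) * (2 : ℕ)))
        ≤ (s ^ 2 * v / 2) ^ 2 * 1 := by
          gcongr
          norm_num [Nat.factorial]
      _ ≤ ((c * s) ^ 2) ^ 2 := by rw [mul_one]; gcongr
      _ = (c * s) ^ 4 := by ring
  calc _ ≤ _ := norm_sub_le_norm_sub_add_norm_sub _ ((1 - s ^ 2 * v / 2 : ℝ) : ℂ) _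
    _ ≤ _ := add_le_add h1 h2

/-- Convergence of the product of the characteristic functions of uniformly bounded centered
random variables with converging averaged variances. -/
lemma tendsto_prod_integral_cexp {ξ : ℕ → Ω → ℝ} (hξ : ∀ i, AEMeasurable (ξ i) P) {c : ℝ}
    (hc : ∀ i, ∀ᵐ ω ∂P, |ξ i ω| ≤ c) (hmean : ∀ i, ∫ ω, ξ i ω ∂P = 0) {v : ℝ}
    (hv : Tendsto (fun n : ℕ => (n : ℝ)⁻¹ * ∑ i ∈ Finset.range n, ∫ ω, ξ i ω ^ 2 ∂P)
      atTop (𝓝 v)) :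
    Tendsto (fun n : ℕ => ∏ i ∈ Finset.range n,
      ∫ ω, Complex.exp (((√n)⁻¹ * ξ i ω : ℝ) * Complex.I) ∂P) atTop
      (𝓝 (Complex.exp (-v / 2 : ℝ))) := by
  have hsqrt : Tendsto (fun n : ℕ => (√n : ℝ)⁻¹) atTop (𝓝 0) :=
    tendsto_inv_atTop_zero.comp (Real.tendsto_sqrt_atTop.comp tendsto_natCast_atTop_atTop)
  have hlim : Tendsto (fun n : ℕ => ∏ i ∈ Finset.range n,
      Complex.exp (-(((√n)⁻¹) ^ 2 * ∫ ω, ξ i ω ^ 2 ∂P) / 2 : ℝ)) atTop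
      (𝓝 (Complex.exp (-v / 2 : ℝ))) := by
    have hcont : Continuous fun v : ℝ => Complex.exp (-v / 2 : ℝ) := by fun_prop
    refine ((hcont.tendsto v).comp hv).congr fun n => ?_
    rw [Function.comp_apply, ← Complex.exp_sum, ← Complex.ofReal_sum]
    congr 2
    rw [← Finset.sum_div, Finset.sum_neg_distrib, ← Finset.mul_sum, inv_pow,
      Real.sq_sqrt (Nat.cast_nonneg n)]
  have hdiff : Tendsto (fun n : ℕ => (∏ i ∈ Finset.range n,
      ∫ ω, Complex.exp (((√n)⁻¹ * ξ i ω : ℝ) * Complex.I) ∂P) - ∏ i ∈ Finset.range n,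
      Complex.exp (-(((√n)⁻¹) ^ 2 * ∫ ω, ξ i ω ^ 2 ∂P) / 2 : ℝ)) atTop (𝓝 0) := by
    have hbound : Tendsto (fun n : ℕ => c ^ 3 * (√n)⁻¹ + c ^ 4 * (√n)⁻¹ ^ 2) atTop (𝓝 0) := by
      simpa using (hsqrt.const_mul (c ^ 3)).add ((hsqrt.pow 2).const_mul (c ^ 4))
    refine squeeze_zero_norm' ?_ hbound
    have hcs : ∀ᶠ n : ℕ in atTop, c * (√n)⁻¹ ≤ 1 := by
      have := hsqrt.const_mul c
      rw [mul_zero] at this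
      exact (this.eventually_lt_const one_pos).mono fun _ h => h.le
    filter_upwards [hcs, eventually_gt_atTop 0] with n hn hn0
    refine (norm_prod_sub_prod_le _ _ _ (fun i _ => ?_) fun i _ => ?_).trans ?_
    · refine (norm_integral_le_of_norm_le_const (C := 1)
        (ae_of_all _ fun ω => (Complex.norm_exp_ofReal_mul_I _).le)).trans (by simp)
    · rw [← Complex.ofReal_exp, Complex.norm_real, Real.norm_eq_abs, Real.abs_exp, Real.exp_le_one_iff]
      have : 0 ≤ ∫ ω, ξ i ω ^ 2 ∂P := integral_nonneg fun ω => sq_nonneg _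
      rw [neg_div]
      exact neg_nonpos.2 (by positivity)
    -- There are n errors, each c³n^(-3/2) + c⁴n^(-2).
    · refine (Finset.sum_le_sum fun i _ => norm_integral_cexp_sub_le (hξ i)
        (by positivity : (0 : ℝ) ≤ (√n)⁻¹) (hc i) hn (hmean i)).trans_eq ?_
      have hne : (√n : ℝ) ≠ 0 := by positivity
      have hsq : (n : ℝ) = √n ^ 2 := (Real.sq_sqrt (Nat.cast_nonneg n)).symm
      rw [Finset.sum_const, Finset.card_range, nsmul_eq_mul]
      nth_rewrite 1 [hsq]
      field_simp
  simpa using hdiff.add hlim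

variable {ι : Type*} [Fintype ι] [DecidableEq ι]

/-- Central limit theorem for independent, uniformly bounded, centered random vectors. -/
lemma tendstoInDistribution_inv_sqrt_smul_sum_of_centered {V : ℕ → Ω → EuclideanSpace ℝ ι}
    (hV : ∀ i, AEMeasurable (V i) P) (hindep : iIndepFun V P) {c : ℝ}
    (hc : ∀ i, ∀ᵐ ω ∂P, ‖V i ω‖ ≤ c) (hmean : ∀ i, ∫ ω, V i ω ∂P = 0) {C : Matrix ι ι ℝ}
    (hpos : C.PosSemidef)
    (hvar : ∀ t : EuclideanSpace ℝ ι, Tendsto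
      (fun n : ℕ => (n : ℝ)⁻¹ * ∑ i ∈ Finset.range n, ∫ ω, (inner ℝ (V i ω) t) ^ 2 ∂P)
      atTop (𝓝 (t.ofLp ⬝ᵥ C.mulVec t.ofLp))) :
    TendstoInDistribution (fun (n : ℕ) (ω : Ω) => (√n)⁻¹ • ∑ i ∈ Finset.range n, V i ω) atTop
      (id : EuclideanSpace ℝ ι → EuclideanSpace ℝ ι) (fun _ => P)
      (multivariateGaussian 0 C) where
  forall_aemeasurable n := (measurable_const_smul _).comp_aemeasurable
    (Finset.aemeasurable_fun_sum _ fun i _ => hV i)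
  tendsto := by
    refine ProbabilityMeasure.tendsto_iff_tendsto_charFun.2 fun t => ?_
    have hint (i) : Integrable (V i) P := Integrable.of_bound (hV i).aestronglyMeasurable c (hc i)
    have hlim := tendsto_prod_integral_cexp (P := P) (ξ := fun i ω => inner ℝ (V i ω) t)
      (fun i => (hV i).inner_const) (c := c * ‖t‖)
      (fun i => (hc i).mono fun ω h => (abs_real_inner_le_norm _ _).trans (by gcongr))
      (fun i => by
        simp_rw [real_inner_comm t]
        rw [integral_inner (hint i), hmean i, inner_zero_right])
      (hvar t)
    have hR : charFun (multivariateGaussian (0 : EuclideanSpace ℝ ι) C) t =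
        Complex.exp (-(t.ofLp ⬝ᵥ C.mulVec t.ofLp) / 2 : ℝ) := by
      rw [charFun_multivariateGaussian hpos]
      congr 1
      simp [neg_div]
    simp only [ProbabilityMeasure.coe_mk, Measure.map_id]
    rw [hR]
    refine hlim.congr fun n => ?_
    rw [charFun_map_smul_comp (Finset.aemeasurable_fun_sum _ fun i _ => hV i),
      (hindep.restrict _).charFun_map_fun_finsetSum_eq_prod (fun i _ => hV i), Finset.prod_apply]
    refine Finset.prod_congr rfl fun i _ => ?_
    rw [charFun_apply, integral_map (hV i) (by fun_prop)]
    simp only [real_inner_smul_right]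

/-- Central limit theorem for independent, uniformly bounded random vectors whose means
eventually sum to zero. -/
lemma tendstoInDistribution_inv_sqrt_smul_sum {V : ℕ → Ω → EuclideanSpace ℝ ι}
    (hV : ∀ i, AEMeasurable (V i) P) (hindep : iIndepFun V P) {c : ℝ}
    (hc : ∀ i, ∀ᵐ ω ∂P, ‖V i ω‖ ≤ c)
    (hmean : ∀ᶠ n in atTop, ∑ i ∈ Finset.range n, ∫ ω, V i ω ∂P = 0) {C : Matrix ι ι ℝ}
    (hpos : C.PosSemidef)
    (hvar : ∀ t : EuclideanSpace ℝ ι, Tendsto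
      (fun n : ℕ => (n : ℝ)⁻¹ * ∑ i ∈ Finset.range n, ∫ ω, (inner ℝ (V i ω) t) ^ 2 ∂P)
      atTop (𝓝 (t.ofLp ⬝ᵥ C.mulVec t.ofLp))) :
    TendstoInDistribution (fun (n : ℕ) (ω : Ω) => (√n)⁻¹ • ∑ i ∈ Finset.range n, V i ω) atTop
      (id : EuclideanSpace ℝ ι → EuclideanSpace ℝ ι) (fun _ => P)
      (multivariateGaussian 0 C) := by
  have hint (i) : Integrable (V i) P := Integrable.of_bound (hV i).aestronglyMeasurable c (hc i)
  set m : ℕ → EuclideanSpace ℝ ι := fun i => ∫ ω, V i ω ∂P with hm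
  have hmle (i) : ‖m i‖ ≤ c := by
    simpa using norm_integral_le_of_norm_le_const (hc i)
  -- Two consecutive partial sums that vanish differ by a single mean.
  have hm0 : ∀ᶠ i in atTop, m i = 0 := by
    filter_upwards [hmean, (tendsto_add_atTop_nat 1).eventually hmean] with n h1 h2
    rwa [Finset.sum_range_succ, h1, zero_add] at h2
  have hclt := tendstoInDistribution_inv_sqrt_smul_sum_of_centered (P := P)
    (V := fun i ω => V i ω - m i) (fun i => (hV i).sub_const _)
    (hindep.comp (fun i x => x - m i) (fun i => by fun_prop)) (c := c + c)
    (fun i => (hc i).mono fun ω h => (norm_sub_le _ _).trans (add_le_add h (hmle i)))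
    (fun i => by rw [integral_sub (hint i) (integrable_const _)]; simp [hm]) hpos
    (fun t => by
      -- The squared means are eventually zero, so centering does not change the limit of the
      -- averaged second moments.
      have hces : Tendsto (fun n : ℕ => (n : ℝ)⁻¹ * ∑ i ∈ Finset.range n, (inner ℝ (m i) t) ^ 2)
          atTop (𝓝 0) := by
        refine Tendsto.cesaro (tendsto_const_nhds.congr' ?_)
        filter_upwards [hm0] with i hi
        simp [hi]
      have := (hvar t).sub hces
      rw [sub_zero] at this
      refine this.congr fun n => ?_
      rw [← mul_sub, ← Finset.sum_sub_distrib]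
      congr 1
      refine Finset.sum_congr rfl fun i _ => ?_
      have hbd : ∀ᵐ ω ∂P, |inner ℝ (V i ω) t| ≤ c * ‖t‖ :=
        (hc i).mono fun ω h => (abs_real_inner_le_norm _ _).trans (by gcongr)
      have hL : MemLp (fun ω => inner ℝ (V i ω) t) 2 P :=
        MemLp.of_bound (hV i).inner_const.aestronglyMeasurable _ hbd
      have hmi : ∫ ω, inner ℝ (V i ω) t ∂P = inner ℝ (m i) t := by
        simp_rw [real_inner_comm t]
        rw [integral_inner (hint i)]
      have hvv := variance_eq_sub hL
      rw [variance_eq_integral hL.aemeasurable] at hvv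
      simp only [hmi, ← inner_sub_left, Pi.pow_apply] at hvv
      exact hvv.symm)
  refine ⟨fun n => (measurable_const_smul _).comp_aemeasurable
      (Finset.aemeasurable_fun_sum _ fun i _ => hV i),
    aemeasurable_id, hclt.tendsto.congr' ?_⟩
  -- Once the means sum to zero, the centered and the original normalized sums coincide exactly.
  filter_upwards [hmean] with n hn
  refine Subtype.ext ?_
  change Measure.map _ P = Measure.map _ P
  congr 1
  funext ω
  rw [Finset.sum_sub_distrib, hn, sub_zero]

end CLT

/-! ### Events of probability tending to one, Slutsky's lemma and the weak law -/

section HighProbability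

variable {Ω : Type*} [MeasurableSpace Ω] {P : Measure Ω}

/-- The events `{ω | p n ω}` have probability tending to one. -/
def HoldsWithHighProb (P : Measure Ω) (p : ℕ → Ω → Prop) : Prop :=
  Tendsto (fun n => P {ω | ¬ p n ω}) atTop (𝓝 0)

lemma HoldsWithHighProb.mono {p q : ℕ → Ω → Prop} (hp : HoldsWithHighProb P p)
    (h : ∀ᶠ n in atTop, ∀ᵐ ω ∂P, p n ω → q n ω) : HoldsWithHighProb P q := by
  refine tendsto_of_tendsto_of_tendsto_of_le_of_le' tendsto_const_nhds hp
    (Eventually.of_forall fun _ => zero_le) ?_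
  filter_upwards [h] with n hn
  refine measure_mono_ae ?_
  filter_upwards [hn] with ω hω hq hp'
  exact hq (hω hp')

lemma HoldsWithHighProb.and {p q : ℕ → Ω → Prop} (hp : HoldsWithHighProb P p)
    (hq : HoldsWithHighProb P q) : HoldsWithHighProb P fun n ω => p n ω ∧ q n ω := by
  have h := Tendsto.add hp hq
  rw [add_zero] at h
  refine tendsto_of_tendsto_of_tendsto_of_le_of_le tendsto_const_nhds h (fun _ => zero_le)
    fun n => ?_
  refine (measure_mono ?_).trans (measure_union_le _ _)
  intro ω hω
  exact not_and_or.1 hω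

lemma HoldsWithHighProb.forall_fintype {κ : Type*} [Fintype κ] {p : κ → ℕ → Ω → Prop}
    (hp : ∀ k, HoldsWithHighProb P (p k)) : HoldsWithHighProb P fun n ω => ∀ k, p k n ω := by
  have h := tendsto_finsetSum Finset.univ fun k _ => hp k
  rw [Finset.sum_const_zero] at h
  refine tendsto_of_tendsto_of_tendsto_of_le_of_le tendsto_const_nhds h (fun _ => zero_le)
    fun n => ?_
  refine (measure_mono ?_).trans (measure_biUnion_finset_le _ _)
  intro ω hω
  obtain ⟨k, hk⟩ := not_forall.1 hω
  exact Set.mem_biUnion (Finset.mem_coe.2 (Finset.mem_univ k)) hk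

lemma tendstoInMeasure_iff_holdsWithHighProb {E : Type*} [SeminormedAddCommGroup E]
    {f : ℕ → Ω → E} {g : Ω → E} :
    TendstoInMeasure P f atTop g ↔
      ∀ ε, 0 < ε → HoldsWithHighProb P fun n ω => ‖f n ω - g ω‖ < ε := by
  simp only [tendstoInMeasure_iff_norm, HoldsWithHighProb, not_lt]

/-- A sequence converging in distribution, multiplied by a sequence converging to zero in
probability, converges to zero in probability. -/
lemma holdsWithHighProb_mul_norm_lt [IsProbabilityMeasure P] {E : Type*} [NormedAddCommGroup E]
    [InnerProductSpace ℝ E] [FiniteDimensional ℝ E] [MeasurableSpace E] [BorelSpace E]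
    {S : ℕ → Ω → E} {μ : Measure E} [IsProbabilityMeasure μ]
    (hS : TendstoInDistribution S atTop (id : E → E) (fun _ => P) μ) {ρ : ℕ → Ω → ℝ}
    (hρ0 : ∀ n ω, 0 ≤ ρ n ω) (hρ : ∀ κ, 0 < κ → HoldsWithHighProb P fun n ω => ρ n ω < κ)
    {ε : ℝ} (hε : 0 < ε) : HoldsWithHighProb P fun n ω => ρ n ω * ‖S n ω‖ < ε := by
  have hm (n) : IsProbabilityMeasure (P.map (S n)) :=
    Measure.isProbabilityMeasure_map (hS.forall_aemeasurable n)
  -- Pointwise convergence of characteristic functions to a continuous limit gives tightness, hence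
  -- a level M that ‖S n‖ exceeds with small probability, uniformly in n.
  have htight : IsTightMeasureSet (Set.range fun n => P.map (S n)) := by
    refine isTightMeasureSet_of_tendsto_charFun (f := charFun μ) (by fun_prop) fun t => ?_
    have := ProbabilityMeasure.tendsto_iff_tendsto_charFun.1 hS.tendsto t
    simpa using this
  have hT := tendsto_measure_norm_gt_of_isTightMeasureSet htight
  rw [HoldsWithHighProb, ENNReal.tendsto_atTop_zero]
  intro η hη
  have hη2 : 0 < η / 2 := ENNReal.half_pos hη.ne'
  obtain ⟨M, hM, hM0⟩ := ((hT.eventually_lt_const hη2).and (eventually_gt_atTop 0)).exists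
  obtain ⟨N, hN⟩ := ENNReal.tendsto_atTop_zero.1 (hρ (ε / M) (by positivity)) (η / 2) hη2
  refine ⟨N, fun n hn => ?_⟩
  have h1 : P {ω | M < ‖S n ω‖} ≤ η / 2 := by
    refine le_trans ?_ hM.le
    have : P {ω | M < ‖S n ω‖} = P.map (S n) {x | M < ‖x‖} := by
      rw [Measure.map_apply_of_aemeasurable (hS.forall_aemeasurable n)
        (measurableSet_lt measurable_const measurable_norm)]
      rfl
    rw [this]
    exact le_iSup₂_of_le (P.map (S n)) (Set.mem_range_self n) le_rfl
  calc P {ω | ¬ ρ n ω * ‖S n ω‖ < ε}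
      ≤ P ({ω | ¬ ρ n ω < ε / M} ∪ {ω | M < ‖S n ω‖}) := by
        refine measure_mono fun ω hω => ?_
        by_contra hcon
        simp only [Set.mem_union, Set.mem_ofPred_eq, not_or, not_lt, not_le] at hcon hω
        have : ρ n ω * ‖S n ω‖ ≤ ρ n ω * M := mul_le_mul_of_nonneg_left hcon.2 (hρ0 n ω)
        have h3 := (lt_div_iff₀ hM0).1 hcon.1
        linarith
    _ ≤ η / 2 + η / 2 := (measure_union_le _ _).trans (add_le_add (hN n hn) h1)
    _ = η := ENNReal.add_halves η

/-- Weak law of large numbers for independent, uniformly bounded random variables. -/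
lemma holdsWithHighProb_abs_avg_sub_lt [IsProbabilityMeasure P] {ξ : ℕ → Ω → ℝ}
    (hξ : ∀ i, AEMeasurable (ξ i) P) (hindep : iIndepFun ξ P) {c : ℝ}
    (hc : ∀ i, ∀ᵐ ω ∂P, |ξ i ω| ≤ c) {ℓ : ℝ}
    (hℓ : Tendsto (fun n : ℕ => (n : ℝ)⁻¹ * ∑ i ∈ Finset.range n, ∫ ω, ξ i ω ∂P) atTop (𝓝 ℓ))
    {ε : ℝ} (hε : 0 < ε) :
    HoldsWithHighProb P fun n ω => |(n : ℝ)⁻¹ * ∑ i ∈ Finset.range n, ξ i ω - ℓ| < ε := by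
  have hL (i) : MemLp (ξ i) 2 P := MemLp.of_bound (hξ i).aestronglyMeasurable c (hc i)
  have hvar (n : ℕ) : variance (∑ i ∈ Finset.range n, ξ i) P ≤ n * c ^ 2 := by
    rw [IndepFun.variance_sum (fun i _ => hL i) fun i _ j _ hij => hindep.indepFun hij]
    refine (Finset.sum_le_sum fun i _ => ?_).trans_eq (by simp : ∑ _i ∈ Finset.range n, c ^ 2 = _)
    refine (variance_le_expectation_sq (hξ i).aestronglyMeasurable).trans ?_
    have := norm_integral_le_of_norm_le_const (μ := P) (f := ξ i ^ 2) (C := c ^ 2)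
      ((hc i).mono fun ω h => by
        rw [Pi.pow_apply, norm_pow]; exact pow_le_pow_left₀ (norm_nonneg _) h 2)
    simpa using (le_abs_self _).trans this
  have hdev : HoldsWithHighProb P fun n ω => |(n : ℝ)⁻¹ * ∑ i ∈ Finset.range n, ξ i ω -
      (n : ℝ)⁻¹ * ∑ i ∈ Finset.range n, ∫ ω, ξ i ω ∂P| < ε / 2 := by
    have hb : Tendsto (fun n : ℕ => ENNReal.ofReal (c ^ 2 / (ε / 2) ^ 2 * (n : ℝ)⁻¹)) atTop
        (𝓝 0) := by
      rw [← ENNReal.ofReal_zero]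
      refine ENNReal.tendsto_ofReal ?_
      simpa using (tendsto_inv_atTop_nhds_zero_nat (𝕜 := ℝ)).const_mul (c ^ 2 / (ε / 2) ^ 2)
    refine tendsto_of_tendsto_of_tendsto_of_le_of_le' tendsto_const_nhds hb
      (Eventually.of_forall fun _ => zero_le) ?_
    filter_upwards [eventually_gt_atTop 0] with n hn
    have hn' : (0 : ℝ) < n := by exact_mod_cast hn
    have hcheb := meas_ge_le_variance_div_sq (memLp_finsetSum' (Finset.range n) fun i _ => hL i)
      (show 0 < n * (ε / 2) by positivity)
    refine (measure_mono ?_).trans (hcheb.trans (ENNReal.ofReal_le_ofReal ?_))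
    · intro ω hω
      simp only [Set.mem_ofPred_eq, not_lt, Finset.sum_apply] at hω ⊢
      rw [integral_finsetSum _ fun i _ => (hL i).integrable (by norm_num)]
      rw [← mul_sub, abs_mul, abs_of_pos (inv_pos.2 hn'), le_inv_mul_iff₀ hn'] at hω
      exact hω
    · calc _ ≤ n * c ^ 2 / (n * (ε / 2)) ^ 2 := by gcongr; exact hvar n
        _ = _ := by field_simp
  refine hdev.mono ?_
  have := (Metric.tendsto_nhds.1 hℓ) (ε / 2) (by positivity)
  filter_upwards [this] with n hn
  refine ae_of_all _ fun ω hω => ?_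
  rw [Real.dist_eq] at hn
  have := abs_sub_le ((n : ℝ)⁻¹ * ∑ i ∈ Finset.range n, ξ i ω)
    ((n : ℝ)⁻¹ * ∑ i ∈ Finset.range n, ∫ ω, ξ i ω ∂P) ℓ
  linarith

end HighProbability

/-! ### From convergence of entries to convergence in operator norm -/

lemma opNorm_le_sum_abs_entries {ι : Type*} [Fintype ι] [DecidableEq ι]
    (T : EuclideanSpace ℝ ι →L[ℝ] EuclideanSpace ℝ ι) :
    ‖T‖ ≤ ∑ k, ∑ j, |T (EuclideanSpace.single k 1) j| := by
  refine T.opNorm_le_bound (by positivity) fun x => ?_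
  have hx : x = ∑ k, x k • EuclideanSpace.single k (1 : ℝ) := by
    ext i
    simp [Finset.sum_apply, Pi.single_apply]
  have hcol (k) : ‖T (EuclideanSpace.single k 1)‖ ≤ ∑ j, |T (EuclideanSpace.single k 1) j| := by
    set y := T (EuclideanSpace.single k 1)
    have hy : y = ∑ j, y j • EuclideanSpace.single j (1 : ℝ) := by
      ext i
      simp [Finset.sum_apply, Pi.single_apply]
    conv_lhs => rw [hy]
    refine (norm_sum_le _ _).trans (Finset.sum_le_sum fun j _ => ?_)
    simp [norm_smul]
  conv_lhs => rw [hx]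
  rw [map_sum, Finset.sum_mul]
  refine (norm_sum_le _ _).trans (Finset.sum_le_sum fun k _ => ?_)
  rw [map_smul, norm_smul, mul_comm]
  gcongr
  · exact hcol k
  · exact PiLp.norm_apply_le x k

lemma holdsWithHighProb_opNorm_sub_lt {Ω : Type*} [MeasurableSpace Ω] {P : Measure Ω}
    {ι : Type*} [Fintype ι] [DecidableEq ι]
    {T : ℕ → Ω → EuclideanSpace ℝ ι →L[ℝ] EuclideanSpace ℝ ι}
    {T₀ : EuclideanSpace ℝ ι →L[ℝ] EuclideanSpace ℝ ι}
    (h : ∀ k j, ∀ ε, 0 < ε → HoldsWithHighProb P fun n ω =>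
      |T n ω (EuclideanSpace.single k 1) j - T₀ (EuclideanSpace.single k 1) j| < ε)
    {ε : ℝ} (hε : 0 < ε) : HoldsWithHighProb P fun n ω => ‖T n ω - T₀‖ < ε := by
  set N : ℝ := (Fintype.card ι : ℝ) with hN
  have hpos : 0 < ε / (N * N + 1) := by positivity
  refine (HoldsWithHighProb.forall_fintype fun k =>
    HoldsWithHighProb.forall_fintype fun j => h k j _ hpos).mono
    (Eventually.of_forall fun n => ae_of_all _ fun ω hω => ?_)
  refine (opNorm_le_sum_abs_entries _).trans_lt ?_
  have hle : ∑ k, ∑ j, |(T n ω - T₀) (EuclideanSpace.single k 1) j| ≤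
      ∑ _k : ι, ∑ _j : ι, ε / (N * N + 1) :=
    Finset.sum_le_sum fun k _ => Finset.sum_le_sum fun j _ => by
      simpa using (hω k j).le
  refine hle.trans_lt ?_
  simp only [Finset.sum_const, Finset.card_univ, nsmul_eq_mul, ← hN]
  rw [← mul_assoc, mul_div_assoc', div_lt_iff₀ (by positivity)]
  nlinarith

/-! ### Reduction of the support vector machine model to logistic regression -/

/-- The piecewise linear function with `log f(y | x; θ) = logisticLog (svmMargin (y x̃ᵀθ))`. -/
noncomputable def svmMargin (t : ℝ) : ℝ := t + (|1 + t| - |1 - t|) / 2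

/-- The slope of `svmMargin` on the linear piece that contains `t`. -/
noncomputable def marginSlope (t : ℝ) : ℝ := if |t| < 1 then 2 else 1

/-- The intercept of `svmMargin` on the linear piece that contains `t`. -/
noncomputable def marginOffset (t : ℝ) : ℝ := if 1 < t then 1 else if t < -1 then -1 else 0

lemma measurable_marginSlope : Measurable marginSlope :=
  Measurable.ite (measurableSet_lt (by fun_prop) measurable_const) measurable_const
    measurable_const

lemma measurable_marginOffset : Measurable marginOffset :=
  Measurable.ite measurableSet_Ioi measurable_const
    (Measurable.ite measurableSet_Iio measurable_const measurable_const)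

lemma abs_marginSlope_le_two (t : ℝ) : |marginSlope t| ≤ 2 := by
  unfold marginSlope
  split_ifs <;> norm_num

lemma abs_marginOffset_le_one (t : ℝ) : |marginOffset t| ≤ 1 := by
  unfold marginOffset
  split_ifs <;> norm_num

/-- An interval that misses both kinks lies in one linear piece, so the slope and the offset read
off at s also serve at t. -/
lemma svmMargin_eq_of_ordConnected {I : Set ℝ} (hI : I.OrdConnected) (h1 : (1 : ℝ) ∉ I)
    (h2 : (-1 : ℝ) ∉ I) {s t : ℝ} (hs : s ∈ I) (ht : t ∈ I) :
    svmMargin t = marginSlope s * t + marginOffset s := by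
  unfold svmMargin marginSlope marginOffset
  rcases lt_trichotomy s 1 with hs1 | rfl | hs1
  · have ht1 : t < 1 := by
      by_contra! hle
      exact h1 (hI.out hs ht ⟨hs1.le, hle⟩)
    rcases lt_trichotomy s (-1) with hs2 | rfl | hs2
    · have ht2 : t < -1 := by
        by_contra! hle
        exact h2 (hI.out hs ht ⟨hs2.le, hle⟩)
      rw [if_neg (by rw [abs_lt]; intro h; linarith [h.1]), if_neg (by linarith), if_pos hs2,
        abs_of_neg (by linarith : 1 + t < 0), abs_of_pos (by linarith : 0 < 1 - t)]
      ring
    · exact absurd hs h2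
    · have ht2 : -1 < t := by
        by_contra! hle
        exact h2 (hI.out ht hs ⟨hle, hs2.le⟩)
      rw [if_pos (abs_lt.2 ⟨hs2, hs1⟩), if_neg (by linarith), if_neg (by linarith),
        abs_of_pos (by linarith : 0 < 1 + t), abs_of_pos (by linarith : 0 < 1 - t)]
      ring
  · exact absurd hs h1
  · have ht1 : 1 < t := by
      by_contra! hle
      exact h1 (hI.out ht hs ⟨hle, hs1.le⟩)
    rw [if_neg (by rw [abs_lt]; intro h; linarith [h.2]), if_pos hs1,
      abs_of_pos (by linarith : 0 < 1 + t), abs_of_neg (by linarith : 1 - t < 0)]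
    ring

lemma not_differentiableAt_svmMargin {t : ℝ} (ht : t = 1 ∨ t = -1) :
    ¬ DifferentiableAt ℝ svmMargin t := by
  intro h
  refine not_differentiableAt_abs_zero ?_
  rcases ht with rfl | rfl
  -- Solving the definition of `svmMargin` for the absolute value that vanishes at the kink leaves
  -- only terms smooth there.
  · have hu : DifferentiableAt ℝ (fun r : ℝ => svmMargin (1 - r)) 0 := by
      refine DifferentiableAt.comp (0 : ℝ) (g := svmMargin) ?_ (by fun_prop)
      simpa using h
    have ha : DifferentiableAt ℝ (fun r : ℝ => |1 + (1 - r)|) 0 :=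
      DifferentiableAt.abs (by fun_prop) (by norm_num)
    have : (abs : ℝ → ℝ) =
        fun r : ℝ => 2 * (1 - r) + |1 + (1 - r)| - 2 * svmMargin (1 - r) := by
      funext r
      unfold svmMargin
      rw [show 1 - (1 - r) = r by ring]
      ring
    rw [this]
    fun_prop
  · have hu : DifferentiableAt ℝ (fun r : ℝ => svmMargin (-1 + r)) 0 := by
      refine DifferentiableAt.comp (0 : ℝ) (g := svmMargin) ?_ (by fun_prop)
      simpa using h
    have ha : DifferentiableAt ℝ (fun r : ℝ => |1 - (-1 + r)|) 0 :=
      DifferentiableAt.abs (by fun_prop) (by norm_num)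
    have : (abs : ℝ → ℝ) =
        fun r : ℝ => 2 * svmMargin (-1 + r) - 2 * (-1 + r) + |1 - (-1 + r)| := by
      funext r
      unfold svmMargin
      rw [show 1 + (-1 + r) = r by ring]
      ring
    rw [this]
    fun_prop

/-- The inner function is recovered smoothly through the inverse of `logisticLog`, which is L ↦
-log(exp(-L) - 1). -/
lemma differentiableAt_of_logisticLog_comp {u : ℝ → ℝ} {t : ℝ}
    (h : DifferentiableAt ℝ (fun r => logisticLog (u r)) t) : DifferentiableAt ℝ u t := by
  have hpos (v : ℝ) : Real.exp (-logisticLog v) - 1 = Real.exp (-v) := by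
    rw [logisticLog, neg_neg, Real.exp_log (by positivity)]
    ring
  have hu : u = fun r => -Real.log (Real.exp (-logisticLog (u r)) - 1) := by
    funext r
    rw [hpos, Real.log_exp, neg_neg]
  rw [hu]
  refine (DifferentiableAt.log (by fun_prop) ?_).neg
  rw [hpos]
  positivity

section Svm

variable {d : ℕ}

lemma continuous_augment : Continuous (augment (d := d)) := by
  refine (PiLp.continuous_toLp 2 _).comp (continuous_pi fun j => ?_)
  refine Fin.cases ?_ (fun i => ?_) j
  · exact continuous_const
  · simp only [Fin.cons_succ]
    fun_prop

lemma augment_ne_zero (x : EuclideanSpace ℝ (Fin d)) : augment x ≠ 0 := by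
  intro h
  have := congrArg (fun v => v 0) h
  simp [augment] at this

lemma svmLogProb_eq_logisticLog {y : ℝ} (hy : y = -1 ∨ y = 1) (x : EuclideanSpace ℝ (Fin d))
    (θ : EuclideanSpace ℝ (Fin (d + 1))) :
    svmLogProb y x θ = logisticLog (svmMargin (y * linPred x θ)) := by
  have hh (r : ℝ) : hingePos r = (r + |r|) / 2 := by
    rcases le_total 0 r with h | h
    · rw [hingePos, max_eq_left h, abs_of_nonneg h]; ring
    · rw [hingePos, max_eq_right h, abs_of_nonpos h]; ring
  -- With two classes, normalized exponentials are the logistic function of the difference of the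
  -- exponents.
  have key (p q : ℝ) : Real.log (Real.exp p / (Real.exp p + Real.exp q)) =
      logisticLog (p - q) := by
    rw [logisticLog, ← Real.log_inv]
    congr 1
    rw [neg_sub, Real.exp_sub]
    field_simp
  unfold svmLogProb svmProb
  rcases hy with rfl | rfl
  · rw [show (1 - -1 * linPred x θ) = 1 + linPred x θ by ring,
      add_comm (Real.exp _), key, hh, hh, svmMargin]
    congr 1
    rw [show 1 + -1 * linPred x θ = 1 - linPred x θ by ring,
      show 1 - -1 * linPred x θ = 1 + linPred x θ by ring]
    ring
  · rw [one_mul, key, hh, hh, svmMargin]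
    congr 1
    ring

/-- The covariate of the logistic regression to which the support vector machine model reduces
near a parameter value at which its log-likelihood is smooth. -/
noncomputable def localCovariate (θ₀ : EuclideanSpace ℝ (Fin (d + 1)))
    (z : EuclideanSpace ℝ (Fin d) × ℝ) : EuclideanSpace ℝ (Fin (d + 1)) :=
  (marginSlope (z.2 * linPred z.1 θ₀) * z.2) • augment z.1

/-- The offset that goes with `localCovariate`. -/
noncomputable def localOffset (θ₀ : EuclideanSpace ℝ (Fin (d + 1)))
    (z : EuclideanSpace ℝ (Fin d) × ℝ) : ℝ :=
  marginOffset (z.2 * linPred z.1 θ₀)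

lemma measurable_mul_linPred (θ₀ : EuclideanSpace ℝ (Fin (d + 1))) :
    Measurable fun z : EuclideanSpace ℝ (Fin d) × ℝ => z.2 * linPred z.1 θ₀ := by
  have := continuous_augment (d := d)
  refine Continuous.measurable ?_
  unfold linPred
  fun_prop

lemma measurable_localCovariate (θ₀ : EuclideanSpace ℝ (Fin (d + 1))) :
    Measurable (localCovariate θ₀) :=
  ((measurable_marginSlope.comp (measurable_mul_linPred θ₀)).mul measurable_snd).smul
    (continuous_augment.measurable.comp measurable_fst)

lemma measurable_localOffset (θ₀ : EuclideanSpace ℝ (Fin (d + 1))) :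
    Measurable (localOffset θ₀) :=
  measurable_marginOffset.comp (measurable_mul_linPred θ₀)

lemma exists_norm_localCovariate_le {𝕏 : Set (EuclideanSpace ℝ (Fin d))} (h𝕏 : IsCompact 𝕏)
    (θ₀ : EuclideanSpace ℝ (Fin (d + 1))) :
    ∃ K, ∀ x ∈ 𝕏, ∀ y, y = -1 ∨ y = 1 → ‖localCovariate θ₀ (x, y)‖ ≤ K := by
  obtain ⟨C, hC⟩ := h𝕏.exists_bound_of_continuousOn continuous_augment.continuousOn
  refine ⟨2 * |C|, fun x hx y hy => ?_⟩
  have hy1 : |y| = 1 := by rcases hy with rfl | rfl <;> simp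
  rw [localCovariate, norm_smul, Real.norm_eq_abs, abs_mul, hy1, mul_one]
  gcongr
  · exact abs_marginSlope_le_two _
  · exact (hC x hx).trans (le_abs_self C)

/-- The image of the convex set U under θ ↦ y x̃ᵀθ is an interval, and a kink in it would destroy
differentiability along the direction x̃. So the linear piece is the one determined by θ₀. -/
lemma svmLogProb_eq_of_differentiableOn {U : Set (EuclideanSpace ℝ (Fin (d + 1)))}
    (hU : IsOpen U) (hconv : Convex ℝ U) {θ₀ : EuclideanSpace ℝ (Fin (d + 1))} (hθ₀ : θ₀ ∈ U)
    {x : EuclideanSpace ℝ (Fin d)} {y : ℝ} (hy : y = -1 ∨ y = 1)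
    (hdiff : DifferentiableOn ℝ (svmLogProb y x) U) :
    ∀ θ ∈ U, svmLogProb y x θ =
      logisticLog (inner ℝ (localCovariate θ₀ (x, y)) θ + localOffset θ₀ (x, y)) := by
  have hy0 : y ≠ 0 := by rcases hy with rfl | rfl <;> norm_num
  set I : Set ℝ := (fun θ => y * linPred x θ) '' U with hI
  have hcont : Continuous fun θ => y * linPred x θ := by unfold linPred; fun_prop
  have hord : I.OrdConnected := (hconv.isPreconnected.image _ hcont.continuousOn).ordConnected
  have hkink : ∀ t ∈ I, t ≠ 1 ∧ t ≠ -1 := by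
    rintro _ ⟨θ, hθ, rfl⟩
    rw [← not_or]
    intro hk
    refine not_differentiableAt_svmMargin hk (differentiableAt_of_logisticLog_comp ?_)
    set t₀ := y * linPred x θ with ht₀
    -- Scaled so that y x̃ᵀθ moves at unit speed along v; restricting to this line turns the
    -- question into one about `svmMargin` in one variable.
    set v : EuclideanSpace ℝ (Fin (d + 1)) := (y * ‖augment x‖ ^ 2)⁻¹ • augment x with hv
    have hlin (r : ℝ) : y * linPred x (θ + (r - t₀) • v) = r := by
      have hn : ‖augment x‖ ≠ 0 := norm_ne_zero_iff.2 (augment_ne_zero x)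
      have : y * linPred x θ = t₀ := rfl
      unfold linPred at this ⊢
      rw [inner_add_right, hv, real_inner_smul_right, real_inner_smul_right,
        real_inner_self_eq_norm_sq, mul_add, this]
      field_simp
      ring
    have heq : (fun r => logisticLog (svmMargin r)) =
        fun r => svmLogProb y x (θ + (r - t₀) • v) := by
      funext r
      rw [svmLogProb_eq_logisticLog hy, hlin]
    rw [heq]
    refine DifferentiableAt.comp t₀ (g := svmLogProb y x) ?_ (by fun_prop)
    simpa using hdiff.differentiableAt (hU.mem_nhds hθ)
  intro θ hθ
  rw [svmLogProb_eq_logisticLog hy, svmMargin_eq_of_ordConnected hord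
    (fun h => (hkink 1 h).1 rfl) (fun h => (hkink _ h).2 rfl)
    (Set.mem_image_of_mem _ hθ₀) (Set.mem_image_of_mem _ hθ), localCovariate, localOffset,
    real_inner_smul_left]
  congr 2
  simp only [linPred]
  ring

lemma svmScore_eq {U : Set (EuclideanSpace ℝ (Fin (d + 1)))} (hU : IsOpen U)
    {θ₀ : EuclideanSpace ℝ (Fin (d + 1))} (hθ₀ : θ₀ ∈ U) {x : EuclideanSpace ℝ (Fin d)} {y : ℝ}
    {w : EuclideanSpace ℝ (Fin (d + 1))} {b : ℝ}
    (heq : ∀ θ ∈ U, svmLogProb y x θ = logisticLog (inner ℝ w θ + b)) (j : Fin (d + 1)) :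
    svmScore y x θ₀ j = ((1 - Real.sigmoid (inner ℝ w θ₀ + b)) • w) j := by
  have hev : svmLogProb y x =ᶠ[𝓝 θ₀] fun θ => logisticLog (inner ℝ w θ + b) :=
    Filter.mem_of_superset (hU.mem_nhds hθ₀) heq
  rw [svmScore, hev.fderiv_eq, (hasFDerivAt_logisticLog_inner w b θ₀).fderiv,
    innerSL_apply_apply, EuclideanSpace.inner_single_right]
  simp

lemma svmHessian_eq {U : Set (EuclideanSpace ℝ (Fin (d + 1)))} (hU : IsOpen U)
    {θ₀ : EuclideanSpace ℝ (Fin (d + 1))} (hθ₀ : θ₀ ∈ U) {x : EuclideanSpace ℝ (Fin d)} {y : ℝ}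
    {w : EuclideanSpace ℝ (Fin (d + 1))} {b : ℝ}
    (heq : ∀ θ ∈ U, svmLogProb y x θ = logisticLog (inner ℝ w θ + b)) (j k : Fin (d + 1)) :
    svmHessian y x θ₀ j k = -(logisticDensity (inner ℝ w θ₀ + b) * w j * w k) := by
  have hev : svmLogProb y x =ᶠ[𝓝 θ₀] fun θ => logisticLog (inner ℝ w θ + b) :=
    Filter.mem_of_superset (hU.mem_nhds hθ₀) heq
  have hfd : fderiv ℝ (fun θ => logisticLog (inner ℝ w θ + b)) =
      fun θ => (1 - Real.sigmoid (inner ℝ w θ + b)) • innerSL ℝ w := by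
    funext θ
    rw [(hasFDerivAt_logisticLog_inner w b θ).fderiv, map_smul]
  have hin : HasFDerivAt (fun θ => inner ℝ w θ + b) (innerSL ℝ w) θ₀ :=
    ((innerSL ℝ w).hasFDerivAt).add_const b
  have hs : HasFDerivAt (fun θ => 1 - Real.sigmoid (inner ℝ w θ + b))
      (-logisticDensity (inner ℝ w θ₀ + b) • innerSL ℝ w) θ₀ := by
    have hc := (hasDerivAt_one_sub_sigmoid (inner ℝ w θ₀ + b)).comp_hasFDerivAt θ₀ hin
    exact hc
  have h2 := hs.smul_const (innerSL ℝ w)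
  rw [svmHessian, Matrix.of_apply, (hev.iteratedFDeriv ℝ 2).eq_of_nhds, iteratedFDeriv_two_apply,
    hfd, h2.fderiv]
  simp [EuclideanSpace.inner_single_right]

end Svm

/-! ### Coercivity and limits of second moment matrices -/

lemma exists_coercive_of_inner_pos {E : Type*} [NormedAddCommGroup E] [InnerProductSpace ℝ E]
    [FiniteDimensional ℝ E] (H : E →L[ℝ] E) (hH : ∀ u, u ≠ 0 → 0 < inner ℝ (H u) u) :
    ∃ c > 0, ∀ u, c * ‖u‖ ^ 2 ≤ inner ℝ (H u) u := by
  -- The sphere is empty only in the zero space, where any c works; otherwise c is the minimum of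
  -- the quadratic form on it.
  rcases (Metric.sphere (0 : E) 1).eq_empty_or_nonempty with hempty | hne
  · refine ⟨1, one_pos, fun u => ?_⟩
    have hu : u = 0 := by
      by_contra hu
      have : ‖u‖⁻¹ • u ∈ Metric.sphere (0 : E) 1 := by simp [norm_smul, hu]
      rw [hempty] at this
      exact this
    simp [hu]
  · obtain ⟨v, hv, hmin⟩ := (isCompact_sphere (0 : E) 1).exists_isMinOn hne
      (f := fun u => inner ℝ (H u) u) (by fun_prop)
    have hv0 : v ≠ 0 := by
      rintro rfl
      simp at hv
    refine ⟨_, hH v hv0, fun u => ?_⟩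
    rcases eq_or_ne u 0 with rfl | hu
    · simp
    have hmem : ‖u‖⁻¹ • u ∈ Metric.sphere (0 : E) 1 := by simp [norm_smul, hu]
    have h := isMinOn_iff.1 hmin _ hmem
    have hn : 0 < ‖u‖ := norm_pos_iff.2 hu
    rw [map_smul, real_inner_smul_left, real_inner_smul_right, ← mul_assoc, ← mul_inv,
      le_inv_mul_iff₀ (by positivity)] at h
    nlinarith

section SecondMoment

variable {Ω : Type*} [MeasurableSpace Ω] {ι : Type*}

/-- The averaged second moment matrix of the first `n` members of a sequence of random vectors. -/
noncomputable def avgSecondMoment (P : Measure Ω) (u : ℕ → Ω → EuclideanSpace ℝ ι) (n : ℕ) :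
    Matrix ι ι ℝ :=
  Matrix.of fun j k => (n : ℝ)⁻¹ * ∑ i ∈ Finset.range n, ∫ ω, u i ω j * u i ω k ∂P

variable {P : Measure Ω} [IsProbabilityMeasure P] [Fintype ι]

lemma integrable_mul_apply {u : Ω → EuclideanSpace ℝ ι} (hu : AEMeasurable u P) {c : ℝ}
    (hc : ∀ᵐ ω ∂P, ‖u ω‖ ≤ c) (j k : ι) : Integrable (fun ω => u ω j * u ω k) P := by
  refine Integrable.of_bound (C := c * c) (by fun_prop) (hc.mono fun ω h => ?_)
  rw [norm_mul]
  have h1 := (PiLp.norm_apply_le (u ω) j).trans h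
  have h2 := (PiLp.norm_apply_le (u ω) k).trans h
  exact mul_le_mul h1 h2 (norm_nonneg _) ((norm_nonneg _).trans h1)

lemma dotProduct_avgSecondMoment_mulVec {u : ℕ → Ω → EuclideanSpace ℝ ι}
    (hu : ∀ i, AEMeasurable (u i) P) {c : ℝ} (hc : ∀ i, ∀ᵐ ω ∂P, ‖u i ω‖ ≤ c) (n : ℕ)
    (t : EuclideanSpace ℝ ι) :
    t.ofLp ⬝ᵥ (avgSecondMoment P u n).mulVec t.ofLp =
      (n : ℝ)⁻¹ * ∑ i ∈ Finset.range n, ∫ ω, (inner ℝ (u i ω) t) ^ 2 ∂P := by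
  have hint (i) : ∫ ω, (inner ℝ (u i ω) t) ^ 2 ∂P =
      ∑ j, ∑ k, t j * t k * ∫ ω, u i ω j * u i ω k ∂P := by
    have hsq (ω : Ω) : (inner ℝ (u i ω) t) ^ 2 =
        ∑ j, ∑ k, t j * t k * (u i ω j * u i ω k) := by
      rw [sq, PiLp.inner_apply, Finset.sum_mul_sum]
      refine Finset.sum_congr rfl fun j _ => Finset.sum_congr rfl fun k _ => ?_
      simp only [RCLike.inner_apply, conj_trivial]
      ring
    simp_rw [hsq]
    rw [integral_finsetSum _ fun j _ => integrable_finsetSum _ fun k _ =>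
      (integrable_mul_apply (hu i) (hc i) j k).const_mul _]
    refine Finset.sum_congr rfl fun j _ => ?_
    rw [integral_finsetSum _ fun k _ => (integrable_mul_apply (hu i) (hc i) j k).const_mul _]
    exact Finset.sum_congr rfl fun k _ => integral_const_mul _ _
  simp_rw [hint]
  rw [Finset.sum_comm, Finset.mul_sum]
  simp only [dotProduct, Matrix.mulVec, avgSecondMoment, Matrix.of_apply]
  refine Finset.sum_congr rfl fun j _ => ?_
  rw [Finset.sum_comm, Finset.mul_sum, Finset.mul_sum]
  refine Finset.sum_congr rfl fun k _ => ?_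
  rw [← Finset.mul_sum]
  ring

lemma continuous_dotProduct_mulVec (t : ι → ℝ) :
    Continuous fun M : Matrix ι ι ℝ => t ⬝ᵥ M.mulVec t := by
  fun_prop

/-- The quadratic form of each average is an average of expected squares, and symmetry and
nonnegativity are closed conditions. -/
lemma posSemidef_of_tendsto_avgSecondMoment {u : ℕ → Ω → EuclideanSpace ℝ ι}
    (hu : ∀ i, AEMeasurable (u i) P) {c : ℝ} (hc : ∀ i, ∀ᵐ ω ∂P, ‖u i ω‖ ≤ c)
    {M : Matrix ι ι ℝ} (hM : Tendsto (avgSecondMoment P u) atTop (𝓝 M)) : M.PosSemidef := by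
  refine .of_dotProduct_mulVec_nonneg ?_ fun t => ?_
  · refine isClosed_eq (continuous_id.matrix_conjTranspose) continuous_id
      |>.mem_of_tendsto hM (Eventually.of_forall fun n => ?_)
    ext j k
    simp [avgSecondMoment, mul_comm]
  · refine ge_of_tendsto (((continuous_dotProduct_mulVec t).tendsto M).comp hM)
      (Eventually.of_forall fun n => ?_)
    have := dotProduct_avgSecondMoment_mulVec hu hc n (WithLp.toLp 2 t)
    simp only [Function.comp_apply]
    rw [this]
    exact mul_nonneg (by positivity)
      (Finset.sum_nonneg fun i _ => integral_nonneg fun ω => sq_nonneg _)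

end SecondMoment

/-! ### Differentiation of the expected log-likelihood -/

section Expectation

variable {Ω : Type*} [MeasurableSpace Ω] {P : Measure Ω} [IsProbabilityMeasure P]
  {E : Type*} [NormedAddCommGroup E] [InnerProductSpace ℝ E] [FiniteDimensional ℝ E]
  [MeasurableSpace E] [BorelSpace E]

lemma abs_logisticLog_le (v : ℝ) : |logisticLog v| ≤ |logisticLog 0| + |v| := by
  have := abs_logisticLog_sub_le 0 v
  rw [sub_zero] at this
  have h2 := abs_sub_abs_le_abs_sub (logisticLog v) (logisticLog 0)
  linarith

lemma integrable_logisticLog {w : Ω → E} {b : Ω → ℝ} (hw : Measurable w) (hb : Measurable b)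
    {K : ℝ} (hK : ∀ᵐ ω ∂P, ‖w ω‖ ≤ K) (hb1 : ∀ ω, |b ω| ≤ 1) (θ : E) :
    Integrable (fun ω => logisticLog (inner ℝ (w ω) θ + b ω)) P := by
  have hm := continuous_logisticLog.measurable
  refine Integrable.of_bound (C := |logisticLog 0| + (K * ‖θ‖ + 1))
    (hm.comp (by fun_prop : Measurable fun ω => inner ℝ (w ω) θ + b ω)).aestronglyMeasurable
    (hK.mono fun ω h => ?_)
  refine (abs_logisticLog_le _).trans ?_
  gcongr
  refine (abs_add_le _ _).trans (add_le_add ((abs_real_inner_le_norm _ _).trans ?_) (hb1 ω))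
  gcongr

/-- Dominated differentiation applies because `logisticLog` is 1-Lipschitz, so that almost every
integrand is Lipschitz in θ with constant |K|. -/
lemma hasFDerivAt_integral_logisticLog {w : Ω → E} {b : Ω → ℝ} (hw : Measurable w)
    (hb : Measurable b) {K : ℝ} (hK : ∀ᵐ ω ∂P, ‖w ω‖ ≤ K) (hb1 : ∀ ω, |b ω| ≤ 1) (θ₀ : E) :
    HasFDerivAt (fun θ => ∫ ω, logisticLog (inner ℝ (w ω) θ + b ω) ∂P)
      (innerSL ℝ (∫ ω, (1 - Real.sigmoid (inner ℝ (w ω) θ₀ + b ω)) • w ω ∂P)) θ₀ := by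
  have hs : Measurable Real.sigmoid := continuous_sigmoid.measurable
  have hmeas : Measurable fun ω => (1 - Real.sigmoid (inner ℝ (w ω) θ₀ + b ω)) • w ω := by
    fun_prop
  have hint : Integrable (fun ω => (1 - Real.sigmoid (inner ℝ (w ω) θ₀ + b ω)) • w ω) P := by
    refine Integrable.of_bound (C := K) hmeas.aestronglyMeasurable (hK.mono fun ω h => ?_)
    rw [norm_smul]
    exact (mul_le_of_le_one_left (norm_nonneg _) (abs_one_sub_sigmoid_le_one _)).trans h
  have h := (hasFDerivAt_integral_of_dominated_loc_of_lip (μ := P) (s := Set.univ)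
    (F := fun θ ω => logisticLog (inner ℝ (w ω) θ + b ω))
    (F' := fun ω => innerSL ℝ ((1 - Real.sigmoid (inner ℝ (w ω) θ₀ + b ω)) • w ω))
    (bound := fun _ => K) (x₀ := θ₀) Filter.univ_mem
    (Eventually.of_forall fun θ => (integrable_logisticLog hw hb hK hb1 θ).aestronglyMeasurable)
    (integrable_logisticLog hw hb hK hb1 θ₀)
    (((innerSL ℝ).continuous.measurable.comp hmeas).aestronglyMeasurable)
    (hK.mono fun ω h => LipschitzOnWith.of_dist_le_mul fun θ _ θ' _ => by
      rw [Real.dist_eq, dist_eq_norm]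
      refine (abs_logisticLog_sub_le _ _).trans ?_
      rw [add_sub_add_right_eq_sub, ← inner_sub_right]
      refine (abs_real_inner_le_norm _ _).trans ?_
      gcongr
      exact h.trans (le_abs_self K))
    (integrable_const K)
    (ae_of_all _ fun ω => hasFDerivAt_logisticLog_inner (w ω) (b ω) θ₀)).2
  rwa [ContinuousLinearMap.integral_comp_comm (innerSL ℝ) hint] at h

end Expectation

/-! ### Asymptotic normality in logistic regression -/

section LogisticRegression

variable {ι : Type*} [Fintype ι]

/-- The score of one observation of the logistic regression with covariate `z.1` and
offset `z.2`. -/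
noncomputable def logisticScore (θ : EuclideanSpace ℝ ι) (z : EuclideanSpace ℝ ι × ℝ) :
    EuclideanSpace ℝ ι :=
  (1 - Real.sigmoid (inner ℝ z.1 θ + z.2)) • z.1

/-- A vector whose outer square is the negative Hessian of one observation of the logistic
regression with covariate `z.1` and offset `z.2`. -/
noncomputable def logisticRootInfo (θ : EuclideanSpace ℝ ι) (z : EuclideanSpace ℝ ι × ℝ) :
    EuclideanSpace ℝ ι :=
  √(logisticDensity (inner ℝ z.1 θ + z.2)) • z.1

lemma measurable_logisticScore (θ : EuclideanSpace ℝ ι) : Measurable (logisticScore θ) := by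
  have := continuous_sigmoid
  refine Continuous.measurable ?_
  unfold logisticScore
  fun_prop

lemma measurable_logisticRootInfo (θ : EuclideanSpace ℝ ι) : Measurable (logisticRootInfo θ) := by
  have := continuous_logisticDensity
  refine Continuous.measurable ?_
  unfold logisticRootInfo
  refine Continuous.smul (Real.continuous_sqrt.comp (this.comp ?_)) ?_ <;> fun_prop

lemma norm_logisticScore_le (θ : EuclideanSpace ℝ ι) (z : EuclideanSpace ℝ ι × ℝ) :
    ‖logisticScore θ z‖ ≤ ‖z.1‖ := by
  rw [logisticScore, norm_smul]
  exact mul_le_of_le_one_left (norm_nonneg _) (abs_one_sub_sigmoid_le_one _)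

lemma norm_logisticRootInfo_le (θ : EuclideanSpace ℝ ι) (z : EuclideanSpace ℝ ι × ℝ) :
    ‖logisticRootInfo θ z‖ ≤ ‖z.1‖ := by
  rw [logisticRootInfo, norm_smul, Real.norm_eq_abs, abs_of_nonneg (Real.sqrt_nonneg _)]
  exact mul_le_of_le_one_left (norm_nonneg _) (Real.sqrt_le_one.2 (logisticDensity_le_one _))

lemma logisticRootInfo_mul (θ : EuclideanSpace ℝ ι) (z : EuclideanSpace ℝ ι × ℝ) (j k : ι) :
    logisticRootInfo θ z j * logisticRootInfo θ z k =
      logisticDensity (inner ℝ z.1 θ + z.2) * z.1 j * z.1 k := by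
  have := Real.mul_self_sqrt (logisticDensity_nonneg (inner ℝ z.1 θ + z.2))
  simp only [logisticRootInfo, PiLp.smul_apply, smul_eq_mul]
  linear_combination (z.1 j * z.1 k) * this

lemma holdsWithHighProb_of_eventually {Ω : Type*} [MeasurableSpace Ω] {P : Measure Ω}
    {p : ℕ → Ω → Prop} (h : ∀ᶠ n in atTop, ∀ᵐ ω ∂P, p n ω) : HoldsWithHighProb P p :=
  tendsto_const_nhds.congr' (h.mono fun _ hn => (ae_iff.1 hn).symm)

variable [DecidableEq ι] {Ω : Type*} [MeasurableSpace Ω] {P : Measure Ω} [IsProbabilityMeasure P]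

/-- Each entry of the negative Hessian is an average of independent products bounded by K², to which
the weak law applies. -/
lemma holdsWithHighProb_logisticAvgInfo {Z : ℕ → Ω → EuclideanSpace ℝ ι × ℝ}
    (hZ : ∀ i, Measurable (Z i)) (hindep : iIndepFun Z P) {K : ℝ}
    (hK : ∀ i, ∀ᵐ ω ∂P, ‖(Z i ω).1‖ ≤ K) (θ₀ : EuclideanSpace ℝ ι) {G : Matrix ι ι ℝ}
    (hG : Tendsto (avgSecondMoment P fun i ω => logisticRootInfo θ₀ (Z i ω)) atTop (𝓝 G))
    {ε : ℝ} (hε : 0 < ε) :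
    HoldsWithHighProb P fun n ω =>
      ‖logisticAvgInfo (fun i => (Z i ω).1) (fun i => (Z i ω).2) n θ₀ -
        Matrix.toEuclideanCLM (𝕜 := ℝ) G‖ < ε := by
  refine holdsWithHighProb_opNorm_sub_lt (fun k j η hη => ?_) hε
  have hm := measurable_logisticRootInfo θ₀
  have hlim : Tendsto (fun n : ℕ => (n : ℝ)⁻¹ * ∑ i ∈ Finset.range n,
      ∫ ω, logisticRootInfo θ₀ (Z i ω) j * logisticRootInfo θ₀ (Z i ω) k ∂P) atTop
      (𝓝 (G j k)) :=
    tendsto_pi_nhds.1 (tendsto_pi_nhds.1 hG j) k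
  have hcoord : Measurable fun z => logisticRootInfo θ₀ z j * logisticRootInfo θ₀ z k :=
    ((EuclideanSpace.proj (𝕜 := ℝ) j).continuous.measurable.comp hm).mul
      ((EuclideanSpace.proj (𝕜 := ℝ) k).continuous.measurable.comp hm)
  have hbd (i) : ∀ᵐ ω ∂P,
      |logisticRootInfo θ₀ (Z i ω) j * logisticRootInfo θ₀ (Z i ω) k| ≤ K * K := by
    refine (hK i).mono fun ω h => ?_
    rw [abs_mul]
    have h1 := ((PiLp.norm_apply_le (logisticRootInfo θ₀ (Z i ω)) j).trans
      (norm_logisticRootInfo_le θ₀ (Z i ω))).trans h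
    have h2 := ((PiLp.norm_apply_le (logisticRootInfo θ₀ (Z i ω)) k).trans
      (norm_logisticRootInfo_le θ₀ (Z i ω))).trans h
    exact mul_le_mul h1 h2 (abs_nonneg _) ((abs_nonneg _).trans h1)
  have hind := hindep.comp
    (fun _ z => logisticRootInfo θ₀ z j * logisticRootInfo θ₀ z k) fun _ => hcoord
  have hwlln := holdsWithHighProb_abs_avg_sub_lt (fun i => (hcoord.comp (hZ i)).aemeasurable)
    hind hbd hlim hη
  refine hwlln.mono (Eventually.of_forall fun n => ae_of_all _ fun ω hω => ?_)
  have e1 : logisticAvgInfo (fun i => (Z i ω).1) (fun i => (Z i ω).2) n θ₀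
      (EuclideanSpace.single k 1) j = (n : ℝ)⁻¹ * ∑ i ∈ Finset.range n,
        logisticRootInfo θ₀ (Z i ω) j * logisticRootInfo θ₀ (Z i ω) k := by
    simp only [logisticAvgInfo, smul_apply, sum_apply, ContinuousLinearMap.smulRight_apply,
      innerSL_apply_apply, EuclideanSpace.inner_single_right, PiLp.smul_apply, smul_eq_mul,
      WithLp.ofLp_sum, Finset.sum_apply, logisticRootInfo_mul, conj_trivial, one_mul]
    congr 1
    exact Finset.sum_congr rfl fun i _ => by ring
  have e2 : Matrix.toEuclideanCLM (𝕜 := ℝ) G (EuclideanSpace.single k 1) j = G j k := by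
    simp [Matrix.ofLp_toEuclideanCLM]
  rw [e1, e2]
  exact hω

/-- Asymptotic normality of consistent local maximizers of a logistic log-likelihood with
independent, uniformly bounded covariates. -/
theorem tendstoInDistribution_logistic_localMax {Z : ℕ → Ω → EuclideanSpace ℝ ι × ℝ}
    (hZ : ∀ i, Measurable (Z i)) (hindep : iIndepFun Z P) {K : ℝ}
    (hK : ∀ i, ∀ᵐ ω ∂P, ‖(Z i ω).1‖ ≤ K) {θ₀ : EuclideanSpace ℝ ι} {G B : Matrix ι ι ℝ}
    (hmean : ∀ᶠ n in atTop, ∑ i ∈ Finset.range n, ∫ ω, logisticScore θ₀ (Z i ω) ∂P = 0)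
    (hG : Tendsto (avgSecondMoment P fun i ω => logisticRootInfo θ₀ (Z i ω)) atTop (𝓝 G))
    (hB : Tendsto (avgSecondMoment P fun i ω => logisticScore θ₀ (Z i ω)) atTop (𝓝 B))
    (hdet : G.det ≠ 0) {U : Set (EuclideanSpace ℝ ι)} (hU : U ∈ 𝓝 θ₀)
    {θhat : ℕ → Ω → EuclideanSpace ℝ ι} (hθm : ∀ n, AEMeasurable (θhat n) P)
    (hθ : TendstoInMeasure P θhat atTop fun _ => θ₀)
    (hmax : ∀ n, ∀ᵐ ω ∂P,
      (∃ θ ∈ U, IsLocalMax (logisticAvg (fun i => (Z i ω).1) (fun i => (Z i ω).2) n) θ) →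
      θhat n ω ∈ U →
        IsLocalMax (logisticAvg (fun i => (Z i ω).1) (fun i => (Z i ω).2) n) (θhat n ω)) :
    TendstoInDistribution (fun (n : ℕ) (ω : Ω) => √n • (θhat n ω - θ₀)) atTop
      (id : EuclideanSpace ℝ ι → EuclideanSpace ℝ ι) (fun _ => P)
      (multivariateGaussian 0 (G⁻¹ * B * G⁻¹)) := by
  have hrm := measurable_logisticRootInfo θ₀
  have hsm := measurable_logisticScore θ₀
  have hKr (i) : ∀ᵐ ω ∂P, ‖logisticRootInfo θ₀ (Z i ω)‖ ≤ K :=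
    (hK i).mono fun ω h => (norm_logisticRootInfo_le θ₀ _).trans h
  have hKs (i) : ∀ᵐ ω ∂P, ‖logisticScore θ₀ (Z i ω)‖ ≤ K :=
    (hK i).mono fun ω h => (norm_logisticScore_le θ₀ _).trans h
  have hGpos : G.PosSemidef :=
    posSemidef_of_tendsto_avgSecondMoment (fun i => (hrm.comp (hZ i)).aemeasurable) hKr hG
  have hBpos : B.PosSemidef :=
    posSemidef_of_tendsto_avgSecondMoment (fun i => (hsm.comp (hZ i)).aemeasurable) hKs hB
  have hGH : G⁻¹.IsHermitian := hGpos.inv.isHermitian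
  have hVpos : (G⁻¹ * B * G⁻¹).PosSemidef := by
    have := hBpos.mul_mul_conjTranspose_same G⁻¹
    rwa [hGH.eq] at this
  have hunit : IsUnit G.det := isUnit_iff_ne_zero.2 hdet
  set H := Matrix.toEuclideanCLM (𝕜 := ℝ) G with hH
  set Hi := Matrix.toEuclideanCLM (𝕜 := ℝ) G⁻¹ with hHi
  have hHiH (u) : Hi (H u) = u := by
    rw [← mul_apply_eq_comp, hH, hHi, ← map_mul, Matrix.nonsing_inv_mul _ hunit,
      map_one, one_apply_eq_self]
  have hHHi (u) : H (Hi u) = u := by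
    rw [← mul_apply_eq_comp, hH, hHi, ← map_mul, Matrix.mul_nonsing_inv _ hunit,
      map_one, one_apply_eq_self]
  obtain ⟨c, hc0, hc⟩ := exists_coercive_of_inner_pos H fun u hu => by
    have h0 : 0 ≤ inner ℝ (H u) u := by
      rw [real_inner_comm, hH, Matrix.inner_toEuclideanCLM]
      exact hGpos.dotProduct_mulVec_nonneg _
    refine lt_of_le_of_ne h0 fun h => hu ?_
    rw [real_inner_comm, hH, Matrix.inner_toEuclideanCLM] at h
    have h2 := (hGpos.dotProduct_mulVec_zero_iff u.ofLp).1 h.symm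
    rw [← hHiH u, show H u = 0 from by
      ext j
      rw [hH, Matrix.ofLp_toEuclideanCLM, h2]
      rfl, map_zero]
  have hK0 : 0 ≤ K := by
    obtain ⟨ω, hω⟩ := (hK 0).exists
    exact (norm_nonneg _).trans hω
  obtain ⟨r, hr0, hrU, hrc⟩ : ∃ r > 0, Metric.ball θ₀ r ⊆ U ∧ K ^ 3 * r ≤ c / 4 := by
    obtain ⟨r₁, hr₁, hsub⟩ := Metric.mem_nhds_iff.1 hU
    refine ⟨min r₁ (c / 4 / (K ^ 3 + 1)), by positivity,
      (Metric.ball_subset_ball (min_le_left _ _)).trans hsub, ?_⟩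
    calc K ^ 3 * min r₁ (c / 4 / (K ^ 3 + 1)) ≤ (K ^ 3 + 1) * (c / 4 / (K ^ 3 + 1)) := by
          gcongr
          · linarith
          · exact min_le_right _ _
      _ = c / 4 := by field_simp
  set g : ℕ → Ω → EuclideanSpace ℝ ι := fun n ω =>
    logisticAvgGrad (fun i => (Z i ω).1) (fun i => (Z i ω).2) n θ₀ with hg
  set T : ℕ → Ω → (EuclideanSpace ℝ ι →L[ℝ] EuclideanSpace ℝ ι) := fun n ω =>
    logisticAvgInfo (fun i => (Z i ω).1) (fun i => (Z i ω).2) n θ₀ with hT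
  set S : ℕ → Ω → EuclideanSpace ℝ ι := fun n ω =>
    (√n)⁻¹ • ∑ i ∈ Finset.range n, Hi (logisticScore θ₀ (Z i ω)) with hS
  have hSg (n : ℕ) (ω : Ω) : S n ω = √n • Hi (g n ω) := by
    simp only [hS, hg, logisticAvgGrad, map_smul, map_sum]
    rw [smul_smul]
    congr 1
    · rw [← div_eq_mul_inv, Real.sqrt_div_self']
      simp
    · exact Finset.sum_congr rfl fun i _ => by rw [logisticScore, map_smul]
  have hclt : TendstoInDistribution S atTop (id : EuclideanSpace ℝ ι → EuclideanSpace ℝ ι)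
      (fun _ => P) (multivariateGaussian 0 (G⁻¹ * B * G⁻¹)) := by
    refine tendstoInDistribution_inv_sqrt_smul_sum (P := P)
      (V := fun i ω => Hi (logisticScore θ₀ (Z i ω)))
      (fun i => (Hi.continuous.measurable.comp (hsm.comp (hZ i))).aemeasurable)
      (hindep.comp (fun _ z => Hi (logisticScore θ₀ z))
        fun _ => Hi.continuous.measurable.comp hsm) (c := ‖Hi‖ * K)
      (fun i => (hKs i).mono fun ω h => (Hi.le_opNorm _).trans (by gcongr)) ?_ hVpos fun t => ?_
    · filter_upwards [hmean] with n hn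
      have hint (i) : Integrable (fun ω => logisticScore θ₀ (Z i ω)) P :=
        Integrable.of_bound (hsm.comp (hZ i)).aestronglyMeasurable K (hKs i)
      simp_rw [fun i => Hi.integral_comp_comm (hint i)]
      rw [← map_sum, hn, map_zero]
    · have hadj (x : EuclideanSpace ℝ ι) : inner ℝ (Hi x) t = inner ℝ x (Hi t) := by
        rw [real_inner_comm, hHi, Matrix.inner_toEuclideanCLM, Matrix.inner_toEuclideanCLM,
          Matrix.dotProduct_mulVec, ← Matrix.mulVec_transpose, dotProduct_comm,
          ← Matrix.conjTranspose_eq_transpose_of_trivial, hGH.eq]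
      have hlim := ((continuous_dotProduct_mulVec (Hi t).ofLp).tendsto B).comp hB
      have heq : t.ofLp ⬝ᵥ (G⁻¹ * B * G⁻¹).mulVec t.ofLp =
          (Hi t).ofLp ⬝ᵥ B.mulVec (Hi t).ofLp := by
        rw [hHi, Matrix.ofLp_toEuclideanCLM, ← Matrix.mulVec_mulVec, ← Matrix.mulVec_mulVec,
          Matrix.dotProduct_mulVec, ← Matrix.mulVec_transpose,
          ← Matrix.conjTranspose_eq_transpose_of_trivial, hGH.eq]
      rw [heq]
      refine hlim.congr fun n => ?_
      simp_rw [hadj]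
      exact dotProduct_avgSecondMoment_mulVec (fun i => (hsm.comp (hZ i)).aemeasurable) hKs n _
  have hTH (κ : ℝ) (hκ : 0 < κ) : HoldsWithHighProb P fun n ω => ‖T n ω - H‖ < κ :=
    holdsWithHighProb_logisticAvgInfo hZ hindep hK θ₀ hG hκ
  have hδ (κ : ℝ) (hκ : 0 < κ) : HoldsWithHighProb P fun n ω => ‖θhat n ω - θ₀‖ < κ :=
    tendstoInMeasure_iff_holdsWithHighProb.1 hθ κ hκ
  have hsqrt : Tendsto (fun n : ℕ => ‖H‖ * (√n : ℝ)⁻¹) atTop (𝓝 0) := by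
    simpa using (tendsto_inv_atTop_zero.comp
      (Real.tendsto_sqrt_atTop.comp tendsto_natCast_atTop_atTop)).const_mul ‖H‖
  have hgsmall : HoldsWithHighProb P fun n ω => ‖g n ω‖ < c * r / 4 := by
    refine (holdsWithHighProb_mul_norm_lt hclt (ρ := fun n _ => ‖H‖ * (√n : ℝ)⁻¹)
      (fun n ω => by positivity) (fun κ hκ => holdsWithHighProb_of_eventually
        ((hsqrt.eventually_lt_const hκ).mono fun n hn => ae_of_all _ fun _ => hn))
      (show 0 < c * r / 4 by positivity)).mono ?_
    filter_upwards [eventually_gt_atTop 0] with n hn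
    refine ae_of_all _ fun ω hω => lt_of_le_of_lt ?_ hω
    have hn' : (0 : ℝ) < √n := by positivity
    rw [hSg, norm_smul, Real.norm_eq_abs, abs_of_pos hn', mul_assoc,
      inv_mul_cancel_left₀ hn'.ne']
    conv_lhs => rw [← hHHi (g n ω)]
    exact H.le_opNorm _
  set ρ : ℕ → Ω → ℝ := fun n ω => ‖Hi‖ * (‖T n ω - H‖ + K ^ 3 * ‖θhat n ω - θ₀‖) with hρdef
  have hρ (κ : ℝ) (hκ : 0 < κ) : HoldsWithHighProb P fun n ω => ρ n ω < κ := by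
    set L := ‖Hi‖ + 1
    have hL : 0 < L := by positivity
    refine ((hTH (κ / (2 * L)) (by positivity)).and
      (hδ (κ / (2 * L * (K ^ 3 + 1))) (by positivity))).mono
      (Eventually.of_forall fun n => ae_of_all _ fun ω hω => ?_)
    calc ρ n ω ≤ L * (‖T n ω - H‖ + (K ^ 3 + 1) * ‖θhat n ω - θ₀‖) := by
          refine mul_le_mul (lt_add_one _).le (add_le_add_right ?_ _) (by positivity) hL.le
          exact mul_le_mul_of_nonneg_right (lt_add_one _).le (norm_nonneg _)
      _ < L * (κ / (2 * L) + (K ^ 3 + 1) * (κ / (2 * L * (K ^ 3 + 1)))) := by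
          have h1 := hω.1
          have h2 := hω.2
          gcongr
      _ = κ := by field_simp; norm_num
  have hKae : ∀ᵐ ω ∂P, ∀ i, ‖(Z i ω).1‖ ≤ K := ae_all_iff.2 hK
  refine tendstoInDistribution_of_tendstoInMeasure_sub _ _ hclt ?_
    fun n => (measurable_const_smul _).comp_aemeasurable ((hθm n).sub_const _)
  rw [tendstoInMeasure_iff_holdsWithHighProb]
  intro ε hε
  refine ((((hTH (c / 4) (by positivity)).and hgsmall).and ((hδ r hr0).and
    (hρ (1 / 2) (by norm_num)))).and
    (holdsWithHighProb_mul_norm_lt hclt (ρ := fun n ω => 2 * ρ n ω)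
      (fun n ω => by positivity) (fun κ hκ => (hρ (κ / 2) (by positivity)).mono
        (Eventually.of_forall fun n => ae_of_all _ fun ω h => by linarith)) hε)).mono
    (Eventually.of_forall fun n => ?_)
  filter_upwards [hKae, hmax n] with ω hKω hmaxω
  rintro ⟨⟨⟨h1, h2⟩, h3, h4⟩, h5⟩
  obtain ⟨θ, hθball, hθmax⟩ := exists_isLocalMax_logisticAvg hKω (fun i => (Z i ω).2) n hr0 hc
    h1.le hrc h2
  have hmem : θhat n ω ∈ U := hrU (by rwa [Metric.mem_ball, dist_eq_norm])
  have hgrad := logisticAvgGrad_eq_zero_of_isLocalMax (hmaxω ⟨θ, hrU hθball, hθmax⟩ hmem)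
  have hlin := norm_sub_le_of_logisticAvgGrad_eq_zero hKω (fun i => (Z i ω).2) n hHiH hgrad
    (ρ := ρ n ω) le_rfl h4.le
  refine lt_of_le_of_lt ?_ h5
  simp only [Pi.sub_apply, Pi.zero_apply, sub_zero]
  rw [hSg, ← smul_sub, norm_smul, norm_smul]
  calc ‖√(n : ℝ)‖ * ‖θhat n ω - θ₀ - Hi (g n ω)‖
      ≤ ‖√(n : ℝ)‖ * (ρ n ω * (2 * ‖Hi (g n ω)‖)) := by gcongr
    _ = _ := by ring

end LogisticRegression

lemma sum_integral_logisticScore_eq_zero {ι : Type*} [Fintype ι] {Ω : Type*} [MeasurableSpace Ω]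
    {P : Measure Ω} [IsProbabilityMeasure P] {Z : ℕ → Ω → EuclideanSpace ℝ ι × ℝ}
    (hZ : ∀ i, Measurable (Z i)) {K : ℝ} (hK : ∀ i, ∀ᵐ ω ∂P, ‖(Z i ω).1‖ ≤ K)
    (hb : ∀ i ω, |(Z i ω).2| ≤ 1) {θ₀ : EuclideanSpace ℝ ι} {n : ℕ} (hn : 0 < n)
    (hmax : IsLocalMax (fun θ => ∫ ω,
      logisticAvg (fun i => (Z i ω).1) (fun i => (Z i ω).2) n θ ∂P) θ₀) :
    ∑ i ∈ Finset.range n, ∫ ω, logisticScore θ₀ (Z i ω) ∂P = 0 := by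
  have heq : (fun θ => ∫ ω, logisticAvg (fun i => (Z i ω).1) (fun i => (Z i ω).2) n θ ∂P) =
      fun θ => (n : ℝ)⁻¹ * ∑ i ∈ Finset.range n,
        ∫ ω, logisticLog (inner ℝ (Z i ω).1 θ + (Z i ω).2) ∂P := by
    funext θ
    simp only [logisticAvg]
    rw [integral_const_mul, integral_finsetSum _ fun i _ =>
      integrable_logisticLog (hZ i).fst (hZ i).snd (hK i) (hb i) θ]
  rw [heq] at hmax
  have hd := (HasFDerivAt.fun_sum (u := Finset.range n) fun i _ =>
    hasFDerivAt_integral_logisticLog (hZ i).fst (hZ i).snd (hK i) (hb i) θ₀).const_mul (n : ℝ)⁻¹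
  have h0 := hmax.hasFDerivAt_eq_zero hd
  have hn' : (n : ℝ)⁻¹ ≠ 0 := inv_ne_zero (by positivity)
  rw [smul_eq_zero_iff_right hn', ← map_sum] at h0
  have h1 := congrArg (fun T => T (∑ i ∈ Finset.range n, ∫ ω, logisticScore θ₀ (Z i ω) ∂P)) h0
  simp only [logisticScore, innerSL_apply_apply, zero_apply, inner_self_eq_zero] at h1
  exact h1

/-- The pairs `(X_i, Y_i)` are independent, not necessarily identically distributed, and nothing
relates their law to the model `f`. Deterministic `X_i = x_i` give the law of the responses
conditional on the covariates; identically distributed pairs give the random design. -/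
theorem proposition3 {d : ℕ} {Ω : Type*} [MeasurableSpace Ω]
    (P : Measure Ω) [IsProbabilityMeasure P]
    (𝕏 : Set (EuclideanSpace ℝ (Fin d))) (h𝕏 : IsCompact 𝕏)
    (S : Set (EuclideanSpace ℝ (Fin (d + 1)))) (hS : IsCompact S)
    -- the data
    (X : ℕ → Ω → EuclideanSpace ℝ (Fin d)) (Y : ℕ → Ω → ℝ)
    (hX_meas : ∀ i, Measurable (X i)) (hY_meas : ∀ i, Measurable (Y i))
    (hX : ∀ i, ∀ᵐ ω ∂P, X i ω ∈ 𝕏)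
    (hY : ∀ i, ∀ᵐ ω ∂P, Y i ω = -1 ∨ Y i ω = 1)
    (h_indep : iIndepFun (fun i ω => (X i ω, Y i ω)) P)
    -- the parameter of interest
    (θ₀ : EuclideanSpace ℝ (Fin (d + 1))) (hθ₀ : θ₀ ∈ interior S)
    (h_max : ∀ᶠ n in atTop, AttainsStrictLocalMax
      (fun θ => ∫ ω, avgLogLik (fun i => X i ω) (fun i => Y i ω) n θ ∂P) θ₀)
    -- smoothness near `θ₀`
    (U : Set (EuclideanSpace ℝ (Fin (d + 1)))) (hU_open : IsOpen U) (hU_conv : Convex ℝ U)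
    (hU_mem : θ₀ ∈ U)
    (h_diff : ∀ i, ∀ᵐ ω ∂P, ThreeTimesDifferentiableOn (svmLogProb (Y i ω) (X i ω)) U)
    -- the limiting matrices
    (A B : Matrix (Fin (d + 1)) (Fin (d + 1)) ℝ)
    (hA : Tendsto (avgExpHessian P X Y θ₀) atTop (𝓝 A))
    (hB : Tendsto (avgExpScoreOuter P X Y θ₀) atTop (𝓝 B))
    (hA_nonsing : A.det ≠ 0)
    -- a consistent sequence of elements of `S_n` (chosen whenever `S_n` is non-empty)
    (θhat : ℕ → Ω → EuclideanSpace ℝ (Fin (d + 1)))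
    (hθhat_meas : ∀ n, AEMeasurable (θhat n) P)
    (hθhat_mem : ∀ n, ∀ᵐ ω ∂P,
      (localMaximizers S (fun i => X i ω) (fun i => Y i ω) n).Nonempty →
        θhat n ω ∈ localMaximizers S (fun i => X i ω) (fun i => Y i ω) n)
    (hθhat_cons : TendstoInMeasure P θhat atTop (fun _ => θ₀)) :
    TendstoInDistribution (fun (n : ℕ) (ω : Ω) => Real.sqrt n • (θhat n ω - θ₀)) atTop
      (id : EuclideanSpace ℝ (Fin (d + 1)) → EuclideanSpace ℝ (Fin (d + 1)))
      (fun _ => P) (multivariateGaussian 0 (A⁻¹ * B * A⁻¹)) := by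
  obtain ⟨K, hK𝕏⟩ := exists_norm_localCovariate_le h𝕏 θ₀
  set φ : EuclideanSpace ℝ (Fin d) × ℝ → EuclideanSpace ℝ (Fin (d + 1)) × ℝ :=
    fun z => (localCovariate θ₀ z, localOffset θ₀ z) with hφ
  have hφm : Measurable φ := (measurable_localCovariate θ₀).prodMk (measurable_localOffset θ₀)
  set Z : ℕ → Ω → EuclideanSpace ℝ (Fin (d + 1)) × ℝ := fun i ω => φ (X i ω, Y i ω) with hZdef
  have hZ (i) : Measurable (Z i) := hφm.comp ((hX_meas i).prodMk (hY_meas i))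
  have hK (i) : ∀ᵐ ω ∂P, ‖(Z i ω).1‖ ≤ K := by
    filter_upwards [hX i, hY i] with ω hx hy using hK𝕏 _ hx _ hy
  have hb (i ω) : |(Z i ω).2| ≤ 1 := abs_marginOffset_le_one _
  have hlog : ∀ᵐ ω ∂P, ∀ i, ∀ θ ∈ U, svmLogProb (Y i ω) (X i ω) θ =
      logisticLog (inner ℝ (Z i ω).1 θ + (Z i ω).2) := by
    rw [ae_all_iff]
    intro i
    filter_upwards [hY i, h_diff i] with ω hy hd
    refine svmLogProb_eq_of_differentiableOn hU_open hU_conv hU_mem hy fun θ hθ => ?_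
    have h0 := hd 0 (by norm_num) θ hθ
    rw [iteratedFDeriv_zero_eq_comp, LinearIsometryEquiv.comp_differentiableWithinAt_iff] at h0
    exact h0
  have havg : ∀ᵐ ω ∂P, ∀ n, ∀ θ ∈ U, avgLogLik (fun i => X i ω) (fun i => Y i ω) n θ =
      logisticAvg (fun i => (Z i ω).1) (fun i => (Z i ω).2) n θ := by
    filter_upwards [hlog] with ω h n θ hθ
    simp only [avgLogLik, logisticAvg, h _ θ hθ]
  have hscore (i j) : (fun ω => svmScore (Y i ω) (X i ω) θ₀ j) =ᵐ[P]
      fun ω => logisticScore θ₀ (Z i ω) j := by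
    filter_upwards [hlog] with ω h using svmScore_eq hU_open hU_mem (h i) j
  have hhess (i j k) : (fun ω => svmHessian (Y i ω) (X i ω) θ₀ j k) =ᵐ[P]
      fun ω => -(logisticRootInfo θ₀ (Z i ω) j * logisticRootInfo θ₀ (Z i ω) k) := by
    filter_upwards [hlog] with ω h
    rw [svmHessian_eq hU_open hU_mem (h i), logisticRootInfo_mul]
  have hG : Tendsto (avgSecondMoment P fun i ω => logisticRootInfo θ₀ (Z i ω)) atTop
      (𝓝 (-A)) := by
    refine hA.neg.congr fun n => ?_
    ext j k
    simp only [avgExpHessian, avgSecondMoment, Matrix.neg_apply, Matrix.of_apply]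
    rw [← mul_neg, ← Finset.sum_neg_distrib]
    congr 1
    refine Finset.sum_congr rfl fun i _ => ?_
    rw [integral_congr_ae (hhess i j k), integral_neg, neg_neg]
  have hB' : Tendsto (avgSecondMoment P fun i ω => logisticScore θ₀ (Z i ω)) atTop (𝓝 B) := by
    refine hB.congr fun n => ?_
    ext j k
    simp only [avgExpScoreOuter, avgSecondMoment, Matrix.of_apply]
    congr 1
    exact Finset.sum_congr rfl fun i _ => integral_congr_ae ((hscore i j).mul (hscore i k))
  have hmean : ∀ᶠ n in atTop,
      ∑ i ∈ Finset.range n, ∫ ω, logisticScore θ₀ (Z i ω) ∂P = 0 := by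
    filter_upwards [h_max, eventually_gt_atTop 0] with n hn hn0
    refine sum_integral_logisticScore_eq_zero hZ hK hb hn0 ?_
    have hint (θ) (hθ : θ ∈ U) :
        ∫ ω, avgLogLik (fun i => X i ω) (fun i => Y i ω) n θ ∂P =
          ∫ ω, logisticAvg (fun i => (Z i ω).1) (fun i => (Z i ω).2) n θ ∂P :=
      integral_congr_ae (havg.mono fun ω h => h n θ hθ)
    filter_upwards [eventually_nhdsWithin_iff.1 hn, hU_open.mem_nhds hU_mem] with θ hθ hθU
    rw [← hint θ hθU, ← hint θ₀ hU_mem]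
    rcases eq_or_ne θ θ₀ with rfl | hne
    · exact le_rfl
    · exact (hθ hne).le
  have hdet : (-A).det ≠ 0 := by
    rw [Matrix.det_neg]
    exact mul_ne_zero (pow_ne_zero _ (by norm_num)) hA_nonsing
  have hmain := tendstoInDistribution_logistic_localMax hZ
    (h_indep.comp (fun _ => φ) fun _ => hφm) hK hmean hG hB' hdet
    (inter_mem (hU_open.mem_nhds hU_mem) (isOpen_interior.mem_nhds hθ₀)) hθhat_meas hθhat_cons
    fun n => by
      filter_upwards [havg, hθhat_mem n] with ω hω hsel
      have hev {θ} (hθ : θ ∈ U) : avgLogLik (fun i => X i ω) (fun i => Y i ω) n =ᶠ[𝓝 θ]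
          logisticAvg (fun i => (Z i ω).1) (fun i => (Z i ω).2) n :=
        Filter.mem_of_superset (hU_open.mem_nhds hθ) (hω n)
      rintro ⟨θ, ⟨hθU, hθS⟩, hθmax⟩ ⟨hθhatU, -⟩
      exact (hsel ⟨θ, hθS, hθmax.congr (hev hθU).symm⟩).2.congr (hev hθhatU)
  have hinv : (-A)⁻¹ * B * (-A)⁻¹ = A⁻¹ * B * A⁻¹ := by
    have : (-A)⁻¹ = -A⁻¹ := by
      refine Matrix.inv_eq_right_inv ?_
      rw [neg_mul_neg, Matrix.mul_nonsing_inv _ (isUnit_iff_ne_zero.2 hA_nonsing)]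
    rw [this, neg_mul, neg_mul_neg]
  rwa [hinv] at hmain
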